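/- All graphs are finite, simple and undirected. For a graph $G$ let $\chi(G)$ be its chromatic number; let $\psi(G)$ (achromatic number) be the largest $k$ such that $G$ has a proper coloring with exactly $k$ colors in which any two distinct color classes are joined by an edge; let $\Gamma(G)$ (Grundy number) be the largest $k$ such that $G$ has a proper coloring $\varphi$ onto $\{1,\dots,k\}$ in which every vertex $v$ has a neighbor of color $i$ for each $1\le i<\varphi(v)$. A graph is called extremal for $h$ if it is connected, $\chi(G)=\Gamma(G)=3$, $\psi(G)=h$, and it has the minimum order among all connected graphs with these parameters. For $h\ge 4$ and $\ell=h-2$, let $L_2(h)$ be the graph with the $2h-2$ vertices $u_1,\dots,u_\ell,w_1,\dots,w_\ell,q_1,q_2$ and the edges $u_iw_j$ ($1\le i<j\le \ell$), $q_1u_i$ and $q_2w_i$ ($1\le i\le \ell$), $q_2u_\ell$ and $q_1q_2$; let $L_1(h)$ be $L_2(h)$ together with the edge $q_1w_1$. Let $L_0$ be the graph on $\{0,\dots,7\}$ with the edges $01,02,03,12,13,45,46,57,06,17$. Theorem. Let $h\ge 4$. A graph is extremal for $h$ if and only if it is connected, $\chi=\Gamma=3$, $\psi=h$, and it has exactly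 $2h-2$ vertices. Moreover, up to isomorphism: (a) for $h=4$ there are exactly seven extremal graphs, namely the graphs on $\{0,\dots,5\}$ with the edges $01$ and $35$ and, respectively, the further edges (1) $02,12,04,15$; (2) $02,12,04,14,15$; (3) $03,12,05,14$; (4) $03,12,04,14,15$; (5) $02,13,04,14,15$; (6) $02,12,13,04,14,15$; (7) $02,12,13,04,14,05$; (b) for $h=5$ there are exactly three extremal graphs, namely $L_0$, $L_1(5)$ and $L_2(5)$; (c) for every $h\ge 6$ there are exactly two extremal graphs, namely $L_1(h)$ and $L_2(h)$. -/

import Mathlib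

universe u

namespace SimpleGraph

/-- A proper coloring with color set `Fin k` is a *complete `k`-coloring* if all `k` colors are used
and there is an edge between any two distinct color classes. -/
def Coloring.IsComplete {V : Type u} {G : SimpleGraph V} {k : ℕ} (C : G.Coloring (Fin k)) : Prop :=
  Function.Surjective C ∧ ∀ i j : Fin k, i ≠ j → ∃ v w : V, G.Adj v w ∧ C v = i ∧ C w = j

/-- A proper coloring with the ordered color set `Fin k` is a *Grundy `k`-coloring* if all `k` colors
are used and every vertex has a neighbor in each color smaller than its own. -/
def Coloring.IsGrundy {V : Type u} {G : SimpleGraph V} {k : ℕ} (C : G.Coloring (Fin k)) : Prop :=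
  Function.Surjective C ∧ ∀ (v : V) (i : Fin k), i < C v → ∃ w : V, G.Adj v w ∧ C w = i

/-- The achromatic number `ψ(G)` of a finite graph: the largest `k` admitting a complete
`k`-coloring. -/
noncomputable def achromaticNumber {V : Type u} (G : SimpleGraph V) : ℕ :=
  sSup {k : ℕ | ∃ C : G.Coloring (Fin k), C.IsComplete}

/-- The Grundy number `Γ(G)` of a finite graph: the largest `k` admitting a Grundy `k`-coloring. -/
noncomputable def grundyNumber {V : Type u} (G : SimpleGraph V) : ℕ :=
  sSup {k : ℕ | ∃ C : G.Coloring (Fin k), C.IsGrundy}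

/-- `G` is a connected graph with `χ(G) = f`, `Γ(G) = g`, `ψ(G) = h`. -/
def Realizes {V : Type u} (G : SimpleGraph V) (f g h : ℕ) : Prop :=
  G.Connected ∧ G.chromaticNumber = (f : ℕ∞) ∧ G.grundyNumber = g ∧ G.achromaticNumber = h

/-- `G` is an *extremal graph* for `(f, g, h)`: it realizes the triple, and no finite graph of
smaller order does. -/
def IsExtremalFor {V : Type u} (G : SimpleGraph V) (f g h : ℕ) : Prop :=
  G.Realizes f g h ∧
    ∀ (m : ℕ) (H : SimpleGraph (Fin m)), H.Realizes f g h → Nat.card V ≤ m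

/-- `G` is *`h`-optimal*: connected, `χ(G) = Γ(G) = 3`, `ψ(G) = h`, and of order `2h - 2`. -/
def IsOptimal {V : Type u} (G : SimpleGraph V) (h : ℕ) : Prop :=
  G.Realizes 3 3 h ∧ Nat.card V = 2 * h - 2

/-- The extremal graphs for `(f, g, h)` on the vertex sets `Fin n`, `n ∈ ℕ`. -/
def ExtremalGraph (f g h : ℕ) : Type :=
  {p : Σ n : ℕ, SimpleGraph (Fin n) // p.2.IsExtremalFor f g h}

/-- Graph isomorphism as an equivalence relation on the extremal graphs. -/
def extremalSetoid (f g h : ℕ) : Setoid (ExtremalGraph f g h) where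
  r p q := Nonempty (p.1.2 ≃g q.1.2)
  iseqv :=
    ⟨fun _ => ⟨Iso.refl⟩, fun ⟨e⟩ => ⟨e.symm⟩, fun ⟨e₁⟩ ⟨e₂⟩ => ⟨e₁.trans e₂⟩⟩

/-- The number of extremal graphs for `(f, g, h)`, counted up to isomorphism. -/
noncomputable def numExtremal (f g h : ℕ) : ℕ :=
  Nat.card (Quotient (extremalSetoid f g h))

/-- The vertices `u_1, …, u_ℓ`, `w_1, …, w_ℓ`, `q_1`, `q_2`; the index `i : Fin ℓ` stands for the
subscript `i + 1`. -/
inductive LVertex (ℓ : ℕ) : Type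
  | u (i : Fin ℓ) : LVertex ℓ
  | w (j : Fin ℓ) : LVertex ℓ
  | q₁ : LVertex ℓ
  | q₂ : LVertex ℓ

/-- The edges common to both graphs, each listed in one direction: `u_i w_j` for `i < j`, all
`q_1 u_i`, all `q_2 w_j`, the edge `q_1 q_2` and the edge `q_2 u_ℓ`. -/
def LVertex.BaseEdge {ℓ : ℕ} : LVertex ℓ → LVertex ℓ → Prop
  | .u i, .w j => i < j
  | .q₁, .u _ => True
  | .q₂, .w _ => True
  | .q₁, .q₂ => True
  | .q₂, .u i => (i : ℕ) + 1 = ℓ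
  | _, _ => False

/-- The edge `q_1 w_1`. -/
def LVertex.ExtraEdge {ℓ : ℕ} : LVertex ℓ → LVertex ℓ → Prop
  | .q₁, .w j => (j : ℕ) = 0
  | _, _ => False

/-- The graph `L_1` of order `2h - 2`, where `ℓ = h - 2`. -/
def L₁ (h : ℕ) : SimpleGraph (LVertex (h - 2)) :=
  SimpleGraph.fromRel fun a b => a.BaseEdge b ∨ a.ExtraEdge b

/-- The graph `L_2` of order `2h - 2`, where `ℓ = h - 2`. -/
def L₂ (h : ℕ) : SimpleGraph (LVertex (h - 2)) :=
  SimpleGraph.fromRel fun a b => a.BaseEdge b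

/-- The graph on `Fin n` with the listed edges. -/
def ofEdgeList {n : ℕ} (E : List (Fin n × Fin n)) : SimpleGraph (Fin n) :=
  SimpleGraph.fromRel fun a b => (a, b) ∈ E

/-- The graph `L_0` on 8 vertices: here `{0}, {1}, {2,4}, {3,5}, {6,7}` is a complete 5-coloring. -/
def L₀ : SimpleGraph (Fin 8) :=
  ofEdgeList [(0, 1), (0, 2), (0, 3), (1, 2), (1, 3), (4, 5), (4, 6), (5, 7), (0, 6), (1, 7)]

/-- The seven graphs on 6 vertices: in each, `{0}, {1}, {2,3}, {4,5}` is a complete 4-coloring. -/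
def fourOptimal : Fin 7 → SimpleGraph (Fin 6) :=
  ![ofEdgeList [(0, 1), (3, 5), (0, 2), (1, 2), (0, 4), (1, 5)],
    ofEdgeList [(0, 1), (3, 5), (0, 2), (1, 2), (0, 4), (1, 4), (1, 5)],
    ofEdgeList [(0, 1), (3, 5), (0, 3), (1, 2), (0, 5), (1, 4)],
    ofEdgeList [(0, 1), (3, 5), (0, 3), (1, 2), (0, 4), (1, 4), (1, 5)],
    ofEdgeList [(0, 1), (3, 5), (0, 2), (1, 3), (0, 4), (1, 4), (1, 5)],
    ofEdgeList [(0, 1), (3, 5), (0, 2), (1, 2), (1, 3), (0, 4), (1, 4), (1, 5)],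
    ofEdgeList [(0, 1), (3, 5), (0, 2), (1, 2), (1, 3), (0, 4), (1, 4), (0, 5)]]

end SimpleGraph

universe v

namespace SimpleGraph

/-! A partial Grundy coloring of an induced subgraph extends greedily to the whole graph. Hence `Γ ≥
4` is equivalent to a configuration on at most eight vertices (`HasGrundyObstruction`), and a graph
without it that is not 2-colorable has `χ = Γ = 3` (`realizes_three_three_iff`).

In a complete `k`-coloring with `k ≥ 4`, three singleton classes would form a triangle whose
vertices all have neighbors in a fourth class, which is an obstruction. So at most two classes are
singletons, the order is at least `2k - 2`, and equality leaves two adjacent vertices `q₁`, `q₂` and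
`k - 2` pairs (`Coloring.IsComplete.card_bound`). As `L₂ h` attains the bound, extremal means
optimal.

Up to exchanging its two vertices, each pair is attached to `q₁ q₂` in one of five ways. A finite
check over two and three pairs shows that exactly one edge joins any two pairs, and which edges can
occur together (`twoPairCheck_all`, `threePairCheck_all`). If no pair is detached, these edges form
a transitive tournament, so the pairs are linearly ordered and the graph is a half graph plus `q₁`,
`q₂`; the only freedom left is whether `q₁` sees the first `w` and `q₂` the last `u`. With neither
edge the graph is bipartite, with both it is `L₁`, and the two remaining choices are exchanged by
reversing the order and give `L₂`. Detached pairs cannot occur among four or more pairs; among three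
they give only `L₀`, and two pairs are settled by enumeration.

Conversely, in a half graph with `q₁`, `q₂` the vertices having a neighbor in a fixed independent
set never contain the path needed for an obstruction (`halfGraph_not_obstruction`). -/

/-- A partial Grundy coloring of an induced subgraph that uses the fourth color, on `r`:
`x, y, z, t` get the first color, `p, s` the second one (`p = s` is allowed) and `q` the third. -/
def HasGrundyObstruction {V : Type u} (G : SimpleGraph V) : Prop :=
  ∃ p q r s x y z t : V, G.Adj p q ∧ G.Adj q r ∧ G.Adj r s ∧ ¬ G.Adj p s ∧
    G.Adj x p ∧ G.Adj y q ∧ G.Adj z r ∧ G.Adj t s ∧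
    ¬ G.Adj x y ∧ ¬ G.Adj x z ∧ ¬ G.Adj x t ∧ ¬ G.Adj y z ∧ ¬ G.Adj y t ∧ ¬ G.Adj z t

/-- `c` is a proper coloring of the subgraph induced on `S` in which every vertex of `S` has a
neighbor in `S` of each smaller color. -/
def IsPartialGrundy {V : Type u} (G : SimpleGraph V) (S : Set V) (c : V → ℕ) : Prop :=
  (∀ v ∈ S, ∀ w ∈ S, G.Adj v w → c v ≠ c w) ∧
    ∀ v ∈ S, ∀ i < c v, ∃ w ∈ S, G.Adj v w ∧ c w = i

/-! ### Greedy extension and the obstruction to Grundy number three -/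

section Greedy

variable {V : Type u} {G : SimpleGraph V}

/-- The new vertex receives the least color absent from its neighbors in `S`; by minimality all
smaller colors occur there. -/
theorem IsPartialGrundy.exists_insert [Finite V] {S : Set V} {c : V → ℕ}
    (h : G.IsPartialGrundy S c) {v : V} (hv : v ∉ S) :
    ∃ c', G.IsPartialGrundy (insert v S) c' ∧ ∀ w ∈ S, c' w = c w := by
  classical
  let A : Set ℕ := {i | ∀ w ∈ S, G.Adj v w → c w ≠ i}
  have hA : A.Nonempty := by
    obtain ⟨i, hi⟩ := Infinite.exists_notMem_finset ((Set.finite_range c).toFinset)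
    exact ⟨i, fun w _ _ hw => hi (by simp [← hw])⟩
  have hS : ∀ w ∈ S, Function.update c v (sInf A) w = c w := fun w hw =>
    Function.update_of_ne (by rintro rfl; exact hv hw) _ _
  have hvm : Function.update c v (sInf A) v = sInf A := Function.update_self _ _ _
  have hmem : sInf A ∈ A := Nat.sInf_mem hA
  refine ⟨Function.update c v (sInf A), ⟨?_, ?_⟩, hS⟩
  · rintro x (rfl | hx) y (rfl | hy) hxy
    · exact absurd hxy (G.loopless.irrefl _)
    · rw [hvm, hS y hy]; exact (hmem y hy hxy).symm
    · rw [hvm, hS x hx]; exact hmem x hx hxy.symm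
    · rw [hS x hx, hS y hy]; exact h.1 x hx y hy hxy
  · rintro x (rfl | hx) i hi
    · rw [hvm] at hi
      have : i ∉ A := Nat.notMem_of_lt_sInf hi
      simp only [A, Set.mem_ofPred_eq, not_forall, not_not] at this
      obtain ⟨w, hw, hvw, hc⟩ := this
      exact ⟨w, Or.inr hw, hvw, (hS w hw).trans hc⟩
    · rw [hS x hx] at hi
      obtain ⟨w, hw, hxw, hc⟩ := h.2 x hx i hi
      exact ⟨w, Or.inr hw, hxw, (hS w hw).trans hc⟩

theorem IsPartialGrundy.exists_extend [Finite V] {S : Set V} {c : V → ℕ}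
    (h : G.IsPartialGrundy S c) :
    ∃ c', G.IsPartialGrundy Set.univ c' ∧ ∀ w ∈ S, c' w = c w := by
  induction hn : Sᶜ.ncard generalizing S c with
  | zero =>
    have : S = Set.univ := by
      rw [Set.ncard_eq_zero (Set.toFinite _)] at hn
      exact Set.compl_empty_iff.mp hn
    subst this
    exact ⟨c, h, fun _ _ => rfl⟩
  | succ n ih =>
    obtain ⟨v, hv⟩ : Sᶜ.Nonempty := by
      rw [← Set.ncard_pos (Set.toFinite _)]; omega
    obtain ⟨c₁, h₁, e₁⟩ := h.exists_insert hv
    have hc : (insert v S)ᶜ.ncard = n := by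
      have : (insert v S)ᶜ = Sᶜ \ {v} := by
        ext x; simp [not_or, and_comm]
      rw [this, Set.ncard_sdiff_singleton_of_mem hv, hn]; rfl
    obtain ⟨c₂, h₂, e₂⟩ := ih h₁ hc
    exact ⟨c₂, h₂, fun w hw => (e₂ w (Or.inr hw)).trans (e₁ w hw)⟩

theorem IsPartialGrundy.exists_isGrundy [Finite V] [Nonempty V] {S : Set V} {c : V → ℕ}
    (h : G.IsPartialGrundy S c) :
    ∃ (k : ℕ) (C : G.Coloring (Fin k)), C.IsGrundy ∧ ∀ v ∈ S, c v < k := by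
  have := Fintype.ofFinite V
  obtain ⟨d, hd, e⟩ := h.exists_extend
  have hlt : ∀ v, d v < Finset.univ.sup d + 1 := fun v =>
    Nat.lt_succ_of_le (Finset.le_sup (Finset.mem_univ v))
  let C : G.Coloring (Fin (Finset.univ.sup d + 1)) :=
    Coloring.mk (fun v => ⟨d v, hlt v⟩) fun {v w} hvw he =>
      hd.1 v trivial w trivial hvw (congrArg Fin.val he)
  have hC : ∀ v, (C v : ℕ) = d v := fun _ => rfl
  refine ⟨_, C, ⟨fun i => ?_, fun v i hi => ?_⟩, fun v hv => (e v hv) ▸ hlt v⟩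
  -- No color is skipped, since a vertex of maximal color sees all smaller ones.
  · obtain ⟨v, -, hv⟩ := Finset.exists_mem_eq_sup Finset.univ Finset.univ_nonempty d
    rcases lt_or_eq_of_le (Nat.le_of_lt_succ i.2) with hi | hi
    · obtain ⟨w, -, -, hw⟩ := hd.2 v trivial i (hv ▸ hi)
      exact ⟨w, Fin.ext hw⟩
    · exact ⟨v, Fin.ext (by rw [hC, hi, hv])⟩
  · obtain ⟨w, -, hvw, hw⟩ := hd.2 v trivial i hi
    exact ⟨w, hvw, Fin.ext hw⟩

theorem HasGrundyObstruction.exists_isGrundy [Finite V] (h : G.HasGrundyObstruction) :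
    ∃ (k : ℕ) (C : G.Coloring (Fin k)), C.IsGrundy ∧ 4 ≤ k := by
  classical
  obtain ⟨p, q, r, s, x, y, z, t, pq, qr, rs, ps, xp, yq, zr, ts, xy, xz, xt, yz, yt, zt⟩ := h
  have yx : ¬ G.Adj y x := fun h => xy h.symm
  have zx : ¬ G.Adj z x := fun h => xz h.symm
  have tx : ¬ G.Adj t x := fun h => xt h.symm
  have zy : ¬ G.Adj z y := fun h => yz h.symm
  have ty : ¬ G.Adj t y := fun h => yt h.symm
  have tz : ¬ G.Adj t z := fun h => zt h.symm
  have sp : ¬ G.Adj s p := fun h => ps h.symm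
  have irr : ∀ v, ¬ G.Adj v v := G.loopless.irrefl
  have hqr : q ≠ r := qr.ne
  have hpr : p ≠ r := by rintro rfl; exact ps rs
  have hsq : s ≠ q := by rintro rfl; exact ps pq
  -- Each of `p, q, r, s` has a neighbor among `x, y, z, t`, whereas these four are pairwise
  -- non-adjacent.
  have hind : ∀ v, v = x ∨ v = y ∨ v = z ∨ v = t → v ≠ p ∧ v ≠ q ∧ v ≠ r ∧ v ≠ s := by
    rintro v (rfl | rfl | rfl | rfl) <;> refine ⟨?_, ?_, ?_, ?_⟩ <;> rintro rfl <;>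
      first | exact irr _ ‹_› | contradiction
  obtain ⟨c, hr, hq, hp, hs, h0⟩ : ∃ c : V → ℕ, c r = 3 ∧ c q = 2 ∧ c p = 1 ∧ c s = 1 ∧
      ∀ v, v = x ∨ v = y ∨ v = z ∨ v = t → c v = 0 := by
    refine ⟨fun v => if v = r then 3 else if v = q then 2 else if v = p ∨ v = s then 1 else 0,
      by simp, by simp [hqr], by simp [hpr, pq.ne], by simp [rs.ne', hsq], fun v hv => ?_⟩
    obtain ⟨h1, h2, h3, h4⟩ := hind v hv
    simp [h1, h2, h3, h4]
  have hx := h0 x (by simp)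
  have hy := h0 y (by simp)
  have hz := h0 z (by simp)
  have ht := h0 t (by simp)
  have hG : G.IsPartialGrundy {p, q, r, s, x, y, z, t} c := by
    constructor
    · rintro v (rfl | rfl | rfl | rfl | rfl | rfl | rfl | rfl) w
        (rfl | rfl | rfl | rfl | rfl | rfl | rfl | rfl) hvw he <;>
      first | exact irr _ hvw | contradiction | (simp only [hr, hq, hp, hs, hx, hy, hz, ht] at he; omega)
    · have key : ∀ v, (∀ i < c v, ∃ w, (w = p ∨ w = q ∨ w = r ∨ w = s ∨ w = x ∨ w = y ∨ w = z ∨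
          w = t) ∧ G.Adj v w ∧ c w = i) → ∀ i < c v, ∃ w ∈ ({p, q, r, s, x, y, z, t} : Set V),
          G.Adj v w ∧ c w = i := fun v h => h
      rintro v (rfl | rfl | rfl | rfl | rfl | rfl | rfl | rfl) <;> apply key <;> intro i hi <;>
        simp only [hr, hq, hp, hs, hx, hy, hz, ht] at hi
      · interval_cases i
        exact ⟨x, by simp, xp.symm, hx⟩
      · interval_cases i
        exacts [⟨y, by simp, yq.symm, hy⟩, ⟨p, by simp, pq.symm, hp⟩]
      · interval_cases i
        exacts [⟨z, by simp, zr.symm, hz⟩, ⟨s, by simp, rs, hs⟩, ⟨q, by simp, qr.symm, hq⟩]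
      · interval_cases i
        exact ⟨t, by simp, ts.symm, ht⟩
      all_goals omega
  have : Nonempty V := ⟨p⟩
  obtain ⟨k, C, hC, hk⟩ := hG.exists_isGrundy
  have := hk r (by simp)
  exact ⟨k, C, hC, by omega⟩

theorem Coloring.IsGrundy.hasGrundyObstruction {k : ℕ} {C : G.Coloring (Fin k)}
    (h : C.IsGrundy) (hk : 4 ≤ k) : G.HasGrundyObstruction := by
  have hne : ∀ {v w}, C v = C w → ¬ G.Adj v w := fun e hvw => C.valid hvw e
  have nb : ∀ (v : V) (i j : Fin k), C v = j → i < j → ∃ w, G.Adj v w ∧ C w = i :=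
    fun v i j hj hij => h.2 v i (hj ▸ hij)
  let c (i : ℕ) (hi : i < 4) : Fin k := ⟨i, by omega⟩
  obtain ⟨r, hr⟩ := h.1 (c 3 (by omega))
  obtain ⟨q, rq, hq⟩ := nb r (c 2 (by omega)) _ hr (by simp [c])
  obtain ⟨s, rs, hs⟩ := nb r (c 1 (by omega)) _ hr (by simp [c])
  obtain ⟨z, rz, hz⟩ := nb r (c 0 (by omega)) _ hr (by simp [c])
  obtain ⟨p, qp, hp⟩ := nb q (c 1 (by omega)) _ hq (by simp [c])
  obtain ⟨y, qy, hy⟩ := nb q (c 0 (by omega)) _ hq (by simp [c])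
  obtain ⟨t, st, ht⟩ := nb s (c 0 (by omega)) _ hs (by simp [c])
  obtain ⟨x, px, hx⟩ := nb p (c 0 (by omega)) _ hp (by simp [c])
  exact ⟨p, q, r, s, x, y, z, t, qp.symm, rq.symm, rs, hne (hp.trans hs.symm), px.symm, qy.symm,
    rz.symm, st.symm, hne (hx.trans hy.symm), hne (hx.trans hz.symm), hne (hx.trans ht.symm),
    hne (hy.trans hz.symm), hne (hy.trans ht.symm), hne (hz.trans ht.symm)⟩

theorem bddAbove_isGrundy [Finite V] (G : SimpleGraph V) :
    BddAbove {k : ℕ | ∃ C : G.Coloring (Fin k), C.IsGrundy} :=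
  ⟨Nat.card V, fun k ⟨_, hC⟩ => by simpa using Nat.card_le_card_of_surjective _ hC.1⟩

theorem bddAbove_isComplete [Finite V] (G : SimpleGraph V) :
    BddAbove {k : ℕ | ∃ C : G.Coloring (Fin k), C.IsComplete} :=
  ⟨Nat.card V, fun k ⟨_, hC⟩ => by simpa using Nat.card_le_card_of_surjective _ hC.1⟩

/-- Any greedy coloring is a Grundy coloring. Without an obstruction it has at most three colors,
and without a 2-coloring at least three, which determines `χ` and `Γ` at once. -/
theorem realizes_three_three_iff [Finite V] {h : ℕ} (hh : 4 ≤ h) :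
    G.Realizes 3 3 h ↔ G.Connected ∧ ¬ G.Colorable 2 ∧ ¬ G.HasGrundyObstruction ∧
      (∃ C : G.Coloring (Fin h), C.IsComplete) ∧
      ∀ (k : ℕ) (C : G.Coloring (Fin k)), C.IsComplete → k ≤ h := by
  constructor
  · rintro ⟨hc, hχ, hΓ, hψ⟩
    refine ⟨hc, fun h2 => ?_, fun ho => ?_, ?_, fun k C hC => ?_⟩
    · have := h2.chromaticNumber_le
      rw [hχ] at this
      exact absurd this (by decide)
    · obtain ⟨k, C, hC, hk⟩ := ho.exists_isGrundy
      have : k ≤ G.grundyNumber := le_csSup (bddAbove_isGrundy G) ⟨C, hC⟩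
      omega
    -- The supremum of the empty set is `0`, which `4 ≤ h` rules out; hence the supremum is
    -- attained.
    · have hne : {k : ℕ | ∃ C : G.Coloring (Fin k), C.IsComplete}.Nonempty := by
        by_contra hn
        rw [Set.not_nonempty_iff_eq_empty] at hn
        rw [achromaticNumber, hn] at hψ
        simp at hψ
        omega
      have := Nat.sSup_mem hne (bddAbove_isComplete G)
      rw [← hψ]
      exact this
    · exact hψ ▸ le_csSup (bddAbove_isComplete G) ⟨C, hC⟩
  · rintro ⟨hc, h2, ho, hC, hmax⟩
    have : Nonempty V := hc.nonempty
    have hle : ∀ (k : ℕ) (C : G.Coloring (Fin k)), C.IsGrundy → k ≤ 3 := by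
      intro k C hC
      by_contra hk
      exact ho (hC.hasGrundyObstruction (by omega))
    obtain ⟨k, C, hG, -⟩ := IsPartialGrundy.exists_isGrundy (G := G) (S := ∅) (c := 0)
      ⟨by simp, by simp⟩
    have hk : k = 3 := by
      have h3 := hle k C hG
      by_contra hne
      exact h2 (Colorable.mono (by omega : k ≤ 2) ⟨C⟩)
    subst hk
    refine ⟨hc, ?_, ?_, ?_⟩
    · refine le_antisymm (Colorable.chromaticNumber_le ⟨C⟩) ?_
      by_contra hlt
      rw [not_le] at hlt
      have : G.chromaticNumber ≤ ((2 : ℕ) : ℕ∞) := by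
        have h3 : ((3 : ℕ) : ℕ∞) = ((2 : ℕ) : ℕ∞) + 1 := rfl
        rw [h3] at hlt
        exact Order.le_of_lt_add_one hlt
      exact h2 (chromaticNumber_le_iff_colorable.mp this)
    · exact IsGreatest.csSup_eq ⟨⟨C, hG⟩, fun k ⟨D, hD⟩ => hle k D hD⟩
    · exact IsGreatest.csSup_eq ⟨hC, fun k ⟨D, hD⟩ => hmax k D hD⟩

end Greedy

/-! ### The lower bound `2h - 2` for the order -/

section Counting

variable {V : Type u} {G : SimpleGraph V}

/-- The three singletons form a triangle, and each has a neighbor in a fourth class, which is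
independent. This is an obstruction with `s = p` and `t = x`. -/
theorem Coloring.IsComplete.hasGrundyObstruction {k : ℕ} {C : G.Coloring (Fin k)}
    (h : C.IsComplete) (hk : 4 ≤ k) {i j l : Fin k} (hij : i ≠ j) (hil : i ≠ l) (hjl : j ≠ l)
    {a b c : V} (ha : ∀ v, C v = i ↔ v = a) (hb : ∀ v, C v = j ↔ v = b)
    (hc : ∀ v, C v = l ↔ v = c) : G.HasGrundyObstruction := by
  obtain ⟨m, hm⟩ : ∃ m, m ∉ ({i, j, l} : Finset (Fin k)) := by
    by_contra hall
    push Not at hall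
    have h1 : (Finset.univ : Finset (Fin k)).card ≤ ({i, j, l} : Finset (Fin k)).card :=
      Finset.card_le_card fun x _ => hall x
    have h2 := Finset.card_le_three (a := i) (b := j) (c := l)
    rw [Finset.card_fin] at h1
    omega
  simp only [Finset.mem_insert, Finset.mem_singleton, not_or] at hm
  have hne : ∀ {v w}, C v = m → C w = m → ¬ G.Adj v w := fun e e' hvw => C.valid hvw (e.trans e'.symm)
  have adj : ∀ {i j : Fin k} {a b : V}, i ≠ j → (∀ v, C v = i ↔ v = a) → (∀ v, C v = j ↔ v = b) →
      G.Adj a b := by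
    intro i j a b hij ha hb
    obtain ⟨v, w, hvw, hv, hw⟩ := h.2 i j hij
    rwa [(ha v).mp hv, (hb w).mp hw] at hvw
  have nb : ∀ {i : Fin k} {a : V}, m ≠ i → (∀ v, C v = i ↔ v = a) → ∃ x, G.Adj x a ∧ C x = m := by
    intro i a hmi ha
    obtain ⟨v, w, hvw, hv, hw⟩ := h.2 m i hmi
    rw [(ha w).mp hw] at hvw
    exact ⟨v, hvw, hv⟩
  obtain ⟨x, xa, hx⟩ := nb hm.1 ha
  obtain ⟨y, yb, hy⟩ := nb hm.2.1 hb
  obtain ⟨z, zc, hz⟩ := nb hm.2.2 hc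
  exact ⟨a, b, c, a, x, y, z, x, adj hij ha hb, adj hjl hb hc, adj hil.symm hc ha,
    G.loopless.irrefl _, xa, yb, zc, xa, hne hx hy, hne hx hz, hne hx hx, hne hy hz, hne hy hx,
    hne hz hx⟩

/-- With at most two singleton classes, adding one to the size of each singleton makes every class
count at least two. Equality in the sum over all classes forces equality in each term. -/
theorem Coloring.IsComplete.card_bound [Finite V] {k : ℕ} {C : G.Coloring (Fin k)}
    (h : C.IsComplete) (hk : 4 ≤ k) (ho : ¬ G.HasGrundyObstruction) :
    2 * k - 2 ≤ Nat.card V ∧ (Nat.card V = 2 * k - 2 →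
      ∃ i j : Fin k, i ≠ j ∧ (∃ a, ∀ v, C v = i ↔ v = a) ∧ (∃ b, ∀ v, C v = j ↔ v = b) ∧
        ∀ l, l ≠ i → l ≠ j → ∃ x y, x ≠ y ∧ ∀ v, C v = l ↔ v = x ∨ v = y) := by
  classical
  have := Fintype.ofFinite V
  let f : Fin k → Finset V := fun i => Finset.univ.filter fun v => C v = i
  let S : Finset (Fin k) := Finset.univ.filter fun i => (f i).card = 1
  have hone : ∀ i ∈ S, ∃ a, ∀ v, C v = i ↔ v = a := by
    intro i hi
    obtain ⟨a, ha⟩ := Finset.card_eq_one.mp (Finset.mem_filter.mp hi).2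
    refine ⟨a, fun v => ?_⟩
    have := congrArg (v ∈ ·) ha
    simpa [f] using this
  have hS : S.card ≤ 2 := by
    by_contra hlt
    obtain ⟨i, j, l, hi, hj, hl, hij, hil, hjl⟩ := Finset.two_lt_card_iff.mp (not_le.mp hlt)
    obtain ⟨a, ha⟩ := hone i hi
    obtain ⟨b, hb⟩ := hone j hj
    obtain ⟨c, hc⟩ := hone l hl
    exact ho (h.hasGrundyObstruction hk hij hil hjl ha hb hc)
  have hpos : ∀ i, 1 ≤ (f i).card := fun i => by
    obtain ⟨v, hv⟩ := h.1 i
    exact Finset.card_pos.mpr ⟨v, by simp [f, hv]⟩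
  have hsum : ∑ i, (f i).card = Nat.card V := by
    rw [Nat.card_eq_fintype_card, ← Finset.card_univ]
    exact (Finset.card_eq_sum_card_fiberwise fun v _ => Finset.mem_coe.mpr (Finset.mem_univ (C v))).symm
  have hcS : ∑ i, (if i ∈ S then 1 else 0) = S.card := by simp
  have hle : ∀ i ∈ Finset.univ, 2 ≤ (f i).card + if i ∈ S then 1 else 0 := by
    intro i _
    have := hpos i
    split_ifs with hi
    · omega
    · have : (f i).card ≠ 1 := fun e => hi (by simp [S, e])
      omega
  have h2 : ∑ _i : Fin k, 2 = 2 * k := by simp [mul_comm]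
  have htot : ∑ i, ((f i).card + if i ∈ S then 1 else 0) = Nat.card V + S.card := by
    rw [Finset.sum_add_distrib, hsum, hcS]
  have hmain := Finset.sum_le_sum hle
  rw [h2, htot] at hmain
  refine ⟨by omega, fun hcard => ?_⟩
  have hS2 : S.card = 2 := by omega
  have heq := (Finset.sum_eq_sum_iff_of_le hle).mp (by rw [h2, htot]; omega)
  obtain ⟨i, j, hij, hSij⟩ := Finset.card_eq_two.mp hS2
  refine ⟨i, j, hij, hone i (by simp [hSij]), hone j (by simp [hSij]), fun l hi hj => ?_⟩
  have hl : (f l).card = 2 := by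
    have := heq l (Finset.mem_univ l)
    rw [if_neg (by simp [hSij, hi, hj])] at this
    omega
  obtain ⟨x, y, hxy, hf⟩ := Finset.card_eq_two.mp hl
  refine ⟨x, y, hxy, fun v => ?_⟩
  have := congrArg (v ∈ ·) hf
  simpa [f] using this

/-- The order already bounds `ψ` from above: more than `h` colors would need more than `2h - 2`
vertices. So one complete `h`-coloring suffices. -/
theorem isOptimal_iff [Finite V] {h : ℕ} (hh : 4 ≤ h) :
    G.IsOptimal h ↔ G.Connected ∧ ¬ G.Colorable 2 ∧ ¬ G.HasGrundyObstruction ∧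
      (∃ C : G.Coloring (Fin h), C.IsComplete) ∧ Nat.card V = 2 * h - 2 := by
  rw [IsOptimal, realizes_three_three_iff hh]
  constructor
  · rintro ⟨⟨h1, h2, h3, h4, -⟩, h5⟩
    exact ⟨h1, h2, h3, h4, h5⟩
  · rintro ⟨h1, h2, h3, h4, h5⟩
    refine ⟨⟨h1, h2, h3, h4, fun k C hC => ?_⟩, h5⟩
    by_contra hk
    have := (hC.card_bound (by omega) h3).1
    omega

theorem Realizes.le_card [Finite V] {h : ℕ} (hh : 4 ≤ h) (hG : G.Realizes 3 3 h) :
    2 * h - 2 ≤ Nat.card V := by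
  obtain ⟨-, -, ho, ⟨C, hC⟩, -⟩ := (realizes_three_three_iff hh).mp hG
  exact (hC.card_bound hh ho).1

end Counting

/-! ### Finite checks for configurations of two and three pairs -/

/-- The ways in which a pair `u_i, w_i` can be attached to the edge `q₁ q₂`, up to exchanging `u_i`
and `w_i`; in each of them, `q₁` is adjacent to `u_i`. -/
inductive PairType
  | detached | full | split | first | last
  deriving DecidableEq

instance : Fintype PairType :=
  ⟨{.detached, .full, .split, .first, .last}, fun τ => by cases τ <;> decide⟩

/-- Whether `q₂` is adjacent to `u_i`. -/
def PairType.qu : PairType → Bool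
  | detached | full | last => true
  | split | first => false

/-- Whether `q₁` is adjacent to `w_i`. -/
def PairType.qw₁ : PairType → Bool
  | full | first => true
  | detached | split | last => false

/-- Whether `q₂` is adjacent to `w_i`. -/
def PairType.qw₂ : PairType → Bool
  | detached => false
  | full | split | first | last => true

/-- The edges that are possible between a pair `u_i, w_i` and a pair `u_j, w_j`. -/
inductive PairEdge
  | uu | uw | wu | ww
  deriving DecidableEq

instance : Fintype PairEdge :=
  ⟨{.uu, .uw, .wu, .ww}, fun r => by cases r <;> decide⟩

/-- The same edge, seen from the other pair. -/
def PairEdge.flip : PairEdge → PairEdge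
  | uu => uu
  | uw => wu
  | wu => uw
  | ww => ww

/-- The vertex set of a configuration with three pairs. -/
inductive Eight
  | q₁ | q₂ | u | w | u' | w' | u'' | w''

namespace Eight

/-- The adjacency of a configuration with three pairs, in one direction. -/
def arc (τ τ' τ'' : PairType) (r r' r'' : PairEdge → Bool) : Eight → Eight → Bool
  | q₁, q₂ => true
  | q₁, u => true
  | q₁, u' => true
  | q₁, u'' => true
  | q₁, w => τ.qw₁
  | q₁, w' => τ'.qw₁
  | q₁, w'' => τ''.qw₁
  | q₂, u => τ.qu
  | q₂, u' => τ'.qu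
  | q₂, u'' => τ''.qu
  | q₂, w => τ.qw₂
  | q₂, w' => τ'.qw₂
  | q₂, w'' => τ''.qw₂
  | u, u' => r .uu
  | u, w' => r .uw
  | w, u' => r .wu
  | w, w' => r .ww
  | u, u'' => r' .uu
  | u, w'' => r' .uw
  | w, u'' => r' .wu
  | w, w'' => r' .ww
  | u', u'' => r'' .uu
  | u', w'' => r'' .uw
  | w', u'' => r'' .wu
  | w', w'' => r'' .ww
  | _, _ => false

end Eight

/-- Search for a Grundy obstruction within the vertices in the list `L`. -/
def searchObstruction {α : Type*} (L : List α) (m : α → α → Bool) : Bool :=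
  L.any fun q => L.any fun r => m q r && L.any fun p => m p q && L.any fun s => m r s && !m p s &&
    L.any fun x => m x p && L.any fun y => m y q && !m x y &&
    L.any fun z => m z r && !m x z && !m y z &&
    L.any fun t => m t s && !m x t && !m y t && !m z t

/-- The map `v` need not be injective: an obstruction is expressed by adjacency and non-adjacency
alone. -/
theorem hasGrundyObstruction_of_search {α : Type*} {V : Type u} {G : SimpleGraph V} {L : List α}
    {m : α → α → Bool} (v : α → V) (h : ∀ x ∈ L, ∀ y ∈ L, (G.Adj (v x) (v y) ↔ m x y = true))
    (hs : searchObstruction L m = true) : G.HasGrundyObstruction := by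
  simp only [searchObstruction, List.any_eq_true, Bool.and_eq_true, Bool.not_eq_true'] at hs
  obtain ⟨q, hq, r, hr, qr, p, hp, pq, s, hs, ⟨rs, ps⟩, x, hx, xp, y, hy, ⟨yq, xy⟩, z, hz,
    ⟨⟨zr, xz⟩, yz⟩, t, ht, ⟨⟨ts, xt⟩, yt⟩, zt⟩ := hs
  have neg : ∀ {x y}, x ∈ L → y ∈ L → m x y = false → ¬ G.Adj (v x) (v y) := by
    intro x y hx hy hxy
    rw [h x hx y hy, hxy]
    exact Bool.false_ne_true
  exact ⟨v p, v q, v r, v s, v x, v y, v z, v t, (h p hp q hq).mpr pq, (h q hq r hr).mpr qr,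
    (h r hr s hs).mpr rs, neg hp hs ps, (h x hx p hp).mpr xp, (h y hy q hq).mpr yq,
    (h z hz r hr).mpr zr, (h t ht s hs).mpr ts, neg hx hy xy, neg hx hz xz, neg hx ht xt,
    neg hy hz yz, neg hy ht yt, neg hz ht zt⟩

/-- The possible edges between two pairs of given types. -/
def pairOk : PairType → PairType → PairEdge → Bool
  | .detached, .detached, .ww => true
  | .detached, .split, .wu => true
  | .detached, .split, .ww => true
  | .detached, .last, .ww => true
  | .detached, .first, .wu => true
  | .split, .detached, .uw => true
  | .split, .detached, .ww => true
  | .last, .detached, .ww => true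
  | .first, .detached, .uw => true
  | .split, .split, _ => true
  | .split, .last, .uw => true
  | .split, .last, .ww => true
  | .last, .split, .wu => true
  | .last, .split, .ww => true
  | .split, .first, .uu => true
  | .split, .first, .wu => true
  | .first, .split, .uu => true
  | .first, .split, .uw => true
  | .last, .last, .ww => true
  | .first, .first, .uu => true
  | .last, .first, .wu => true
  | .first, .last, .uw => true
  | _, _, _ => false

def PairType.all (f : PairType → Bool) : Bool :=
  f .detached && f .full && f .split && f .first && f .last

def PairEdge.all (f : PairEdge → Bool) : Bool :=
  f .uu && f .uw && f .wu && f .ww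

def allBool (f : Bool → Bool) : Bool := f false && f true

theorem PairType.all_iff (f : PairType → Bool) : PairType.all f = true ↔ ∀ τ, f τ = true := by
  simp only [PairType.all, Bool.and_eq_true]
  exact ⟨fun h τ => by cases τ <;> tauto, fun h => by simp [h]⟩

theorem PairEdge.all_iff (f : PairEdge → Bool) : PairEdge.all f = true ↔ ∀ r, f r = true := by
  simp only [PairEdge.all, Bool.and_eq_true]
  exact ⟨fun h τ => by cases τ <;> tauto, fun h => by simp [h]⟩

theorem allBool_iff (f : Bool → Bool) : allBool f = true ↔ ∀ b, f b = true := by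
  simp only [allBool, Bool.and_eq_true]
  exact ⟨fun h b => by cases b <;> tauto, fun h => by simp [h]⟩

/-- The relation consisting of the given edges. -/
def PairEdge.rel (b₁ b₂ b₃ b₄ : Bool) : PairEdge → Bool
  | uu => b₁
  | uw => b₂
  | wu => b₃
  | ww => b₄

/-- The relation consisting of a single edge. -/
def PairEdge.only : PairEdge → PairEdge → Bool
  | uu, uu => true
  | uw, uw => true
  | wu, wu => true
  | ww, ww => true
  | _, _ => false

-- The third type and the last two relations are placeholders, as `u''` and `w''` are not in the
-- searched list.
open Eight in
def twoPairCheck (τ τ' : PairType) (b₁ b₂ b₃ b₄ : Bool) : Bool :=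
  searchObstruction [q₁, q₂, u, w, u', w'] (fun x y =>
    arc τ τ' .split (PairEdge.rel b₁ b₂ b₃ b₄) (fun _ => false) (fun _ => false) x y ||
    arc τ τ' .split (PairEdge.rel b₁ b₂ b₃ b₄) (fun _ => false) (fun _ => false) y x)

/-- All sixteen edge sets between two pairs are tested for all types. Two or more edges always give
an obstruction, and a single edge does so unless `pairOk` allows it. -/
theorem twoPairCheck_all : (PairType.all fun τ => PairType.all fun τ' => allBool fun b₁ =>
    allBool fun b₂ => allBool fun b₃ => allBool fun b₄ =>
      twoPairCheck τ τ' b₁ b₂ b₃ b₄ || (!b₁ && !b₂ && !b₃ && !b₄) ||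
      (b₁ && !b₂ && !b₃ && !b₄ && pairOk τ τ' .uu) || (!b₁ && b₂ && !b₃ && !b₄ && pairOk τ τ' .uw) ||
      (!b₁ && !b₂ && b₃ && !b₄ && pairOk τ τ' .wu) ||
      (!b₁ && !b₂ && !b₃ && b₄ && pairOk τ τ' .ww)) = true := by
  decide +kernel

open Eight in
def threePairCheck (τ τ' τ'' : PairType) (r r' r'' : PairEdge) : Bool :=
  searchObstruction [q₁, q₂, u, w, u', w', u'', w''] (fun x y =>
    arc τ τ' τ'' r.only r'.only r''.only x y || arc τ τ' τ'' r.only r'.only r''.only y x)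

/-- The possible edges between three pairs of given types. -/
def tripleOk : PairType → PairType → PairType → PairEdge → PairEdge → PairEdge → Bool
  | .detached, .detached, .detached, .ww, .ww, .ww => true
  | .detached, .detached, .split, .ww, .wu, .ww => true
  | .detached, .detached, .split, .ww, .ww, .wu => true
  | .detached, .split, .detached, .wu, .ww, .ww => true
  | .detached, .split, .detached, .ww, .ww, .uw => true
  | .split, .detached, .detached, .uw, .ww, .ww => true
  | .split, .detached, .detached, .ww, .uw, .ww => true
  | .detached, _, _, _, _, _ => false
  | _, .detached, _, _, _, _ => false
  | _, _, .detached, _, _, _ => false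
  | _, _, _, .uw, .uw, .uw => true
  | _, _, _, .uw, .uw, .wu => true
  | _, _, _, .uw, .wu, .wu => true
  | _, _, _, .wu, .uw, .uw => true
  | _, _, _, .wu, .wu, .uw => true
  | _, _, _, .wu, .wu, .wu => true
  | _, _, _, _, _, _ => false

/-- Only combinations that pass `pairOk` on all three pairs of pairs have to be searched. -/
theorem threePairCheck_all : (PairType.all fun τ => PairType.all fun τ' => PairEdge.all fun r =>
    !pairOk τ τ' r || PairType.all fun τ'' => PairEdge.all fun r' => !pairOk τ τ'' r' ||
      PairEdge.all fun r'' => !pairOk τ' τ'' r'' || tripleOk τ τ' τ'' r r' r'' ||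
        threePairCheck τ τ' τ'' r r' r'') = true := by
  decide +kernel

/-! ### Optimal graphs as systems of pairs -/

section PairStructure

variable {V : Type u} {G : SimpleGraph V}

/-- The pair `u, w` is attached to the edge `a b` as described by `τ`. -/
structure HasPairType (G : SimpleGraph V) (a b u w : V) (τ : PairType) : Prop where
  au : G.Adj a u
  bu : G.Adj b u ↔ τ.qu = true
  aw : G.Adj a w ↔ τ.qw₁ = true
  bw : G.Adj b w ↔ τ.qw₂ = true
  uw : ¬ G.Adj u w

/-- The edges between the pairs `u, w` and `u', w'` are those in `r`. -/
structure HasPairRel (G : SimpleGraph V) (u w u' w' : V) (r : PairEdge → Bool) : Prop where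
  uu : G.Adj u u' ↔ r .uu = true
  uw : G.Adj u w' ↔ r .uw = true
  wu : G.Adj w u' ↔ r .wu = true
  ww : G.Adj w w' ↔ r .ww = true

/-- Nine adjacency patterns satisfy the hypotheses. One is symmetric (`full`), and the other eight
fall into four types under exchanging `x` and `y`. -/
theorem exists_hasPairType {a b x y : V} (hxy : ¬ G.Adj x y) (ha : G.Adj a x ∨ G.Adj a y)
    (hb : G.Adj b x ∨ G.Adj b y) :
    ∃ (u w : V) (τ : PairType), (u = x ∧ w = y ∨ u = y ∧ w = x) ∧ G.HasPairType a b u w τ := by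
  have hyx : ¬ G.Adj y x := fun h => hxy h.symm
  have mk : ∀ {u w : V} (τ : PairType), ¬ G.Adj u w → G.Adj a u → (G.Adj b u ↔ τ.qu = true) →
      (G.Adj a w ↔ τ.qw₁ = true) → (G.Adj b w ↔ τ.qw₂ = true) → G.HasPairType a b u w τ :=
    fun τ h1 h2 h3 h4 h5 => ⟨h2, h3, h4, h5, h1⟩
  by_cases ax : G.Adj a x <;> by_cases ay : G.Adj a y <;> by_cases bx : G.Adj b x <;>
    by_cases bY : G.Adj b y <;> simp only [ax, ay, bx, bY, or_self, or_false, false_or] at ha hb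
  · exact ⟨x, y, .full, by simp, mk _ hxy ax (by simp [bx, PairType.qu])
      (by simp [ay, PairType.qw₁]) (by simp [bY, PairType.qw₂])⟩
  · exact ⟨y, x, .first, by simp, mk _ hyx ay (by simp [bY, PairType.qu])
      (by simp [ax, PairType.qw₁]) (by simp [bx, PairType.qw₂])⟩
  · exact ⟨x, y, .first, by simp, mk _ hxy ax (by simp [bx, PairType.qu])
      (by simp [ay, PairType.qw₁]) (by simp [bY, PairType.qw₂])⟩
  · exact ⟨x, y, .last, by simp, mk _ hxy ax (by simp [bx, PairType.qu])
      (by simp [ay, PairType.qw₁]) (by simp [bY, PairType.qw₂])⟩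
  · exact ⟨x, y, .detached, by simp, mk _ hxy ax (by simp [bx, PairType.qu])
      (by simp [ay, PairType.qw₁]) (by simp [bY, PairType.qw₂])⟩
  · exact ⟨x, y, .split, by simp, mk _ hxy ax (by simp [bx, PairType.qu])
      (by simp [ay, PairType.qw₁]) (by simp [bY, PairType.qw₂])⟩
  · exact ⟨y, x, .last, by simp, mk _ hyx ay (by simp [bY, PairType.qu])
      (by simp [ax, PairType.qw₁]) (by simp [bx, PairType.qw₂])⟩
  · exact ⟨y, x, .split, by simp, mk _ hyx ay (by simp [bY, PairType.qu])
      (by simp [ax, PairType.qw₁]) (by simp [bx, PairType.qw₂])⟩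
  · exact ⟨y, x, .detached, by simp, mk _ hyx ay (by simp [bY, PairType.qu])
      (by simp [ax, PairType.qw₁]) (by simp [bx, PairType.qw₂])⟩

theorem hasGrundyObstruction_of_twoPairCheck {a b u w u' w' : V} {τ τ' : PairType}
    {b₁ b₂ b₃ b₄ : Bool} (hab : G.Adj a b) (h : G.HasPairType a b u w τ)
    (h' : G.HasPairType a b u' w' τ') (hr : G.HasPairRel u w u' w' (PairEdge.rel b₁ b₂ b₃ b₄))
    (hs : twoPairCheck τ τ' b₁ b₂ b₃ b₄ = true) : G.HasGrundyObstruction := by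
  refine hasGrundyObstruction_of_search (fun i => match i with
    | .q₁ => a | .q₂ => b | .u => u | .w => w | .u' => u' | .w' => w' | _ => a) ?_ hs
  intro x hx y hy
  obtain ⟨h1, h2, h3, h4, h5⟩ := h
  obtain ⟨k1, k2, k3, k4, k5⟩ := h'
  obtain ⟨r1, r2, r3, r4⟩ := hr
  cases x <;> cases y <;> simp_all [Eight.arc, G.adj_comm]

theorem hasGrundyObstruction_of_threePairCheck {a b u w u' w' u'' w'' : V} {τ τ' τ'' : PairType}
    {r r' r'' : PairEdge} (hab : G.Adj a b) (h : G.HasPairType a b u w τ)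
    (h' : G.HasPairType a b u' w' τ') (h'' : G.HasPairType a b u'' w'' τ'')
    (hr : G.HasPairRel u w u' w' r.only) (hr' : G.HasPairRel u w u'' w'' r'.only)
    (hr'' : G.HasPairRel u' w' u'' w'' r''.only)
    (hs : threePairCheck τ τ' τ'' r r' r'' = true) : G.HasGrundyObstruction := by
  refine hasGrundyObstruction_of_search (fun i => match i with
    | .q₁ => a | .q₂ => b | .u => u | .w => w | .u' => u' | .w' => w' | .u'' => u'' | .w'' => w'')
    ?_ hs
  intro x _ y _
  obtain ⟨h1, h2, h3, h4, h5⟩ := h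
  obtain ⟨k1, k2, k3, k4, k5⟩ := h'
  obtain ⟨l1, l2, l3, l4, l5⟩ := h''
  obtain ⟨r1, r2, r3, r4⟩ := hr
  obtain ⟨s1, s2, s3, s4⟩ := hr'
  obtain ⟨t1, t2, t3, t4⟩ := hr''
  have sy : ∀ {x y : V} {c : Bool}, (G.Adj x y ↔ c = true) → (G.Adj y x ↔ c = true) :=
    fun h => (G.adj_comm _ _).trans h
  have ns : ∀ {x y : V}, ¬ G.Adj x y → ¬ G.Adj y x := fun h h' => h h'.symm
  cases x <;> cases y <;> simp only [Eight.arc, Bool.or_false, Bool.false_or, Bool.or_self,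
    Bool.or_true] <;>
    first
    | assumption
    | exact iff_of_true ‹_› trivial
    | exact iff_of_true (G.adj_symm ‹_›) trivial
    | exact sy ‹_›
    | exact iff_of_false (G.loopless.irrefl _) Bool.false_ne_true
    | exact iff_of_false ‹_› Bool.false_ne_true
    | exact iff_of_false (ns ‹_›) Bool.false_ne_true

/-- Completeness of the coloring supplies one edge between the pairs; absence of an obstruction
excludes a second one. -/
theorem exists_pairEdge {a b u w u' w' : V} {τ τ' : PairType} (ho : ¬ G.HasGrundyObstruction)
    (hab : G.Adj a b) (h : G.HasPairType a b u w τ) (h' : G.HasPairType a b u' w' τ')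
    (hr : G.Adj u u' ∨ G.Adj u w' ∨ G.Adj w u' ∨ G.Adj w w') :
    ∃ r : PairEdge, G.HasPairRel u w u' w' r.only ∧ pairOk τ τ' r = true := by
  classical
  have key := twoPairCheck_all
  simp only [PairType.all_iff, allBool_iff] at key
  have key := key τ τ' (decide (G.Adj u u')) (decide (G.Adj u w')) (decide (G.Adj w u'))
    (decide (G.Adj w w'))
  have hn : ¬ twoPairCheck τ τ' (decide (G.Adj u u')) (decide (G.Adj u w')) (decide (G.Adj w u'))
      (decide (G.Adj w w')) = true := fun hs =>
    ho (hasGrundyObstruction_of_twoPairCheck hab h h'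
      ⟨by simp [PairEdge.rel], by simp [PairEdge.rel], by simp [PairEdge.rel],
        by simp [PairEdge.rel]⟩ hs)
  simp only [Bool.or_eq_true, hn, Bool.and_eq_true, Bool.not_eq_true',
    decide_eq_true_eq, decide_eq_false_iff_not] at key
  rcases key with (((⟨⟨⟨e1, e2⟩, e3⟩, e4⟩ | ⟨⟨⟨⟨e1, e2⟩, e3⟩, e4⟩, hp⟩) |
    ⟨⟨⟨⟨e1, e2⟩, e3⟩, e4⟩, hp⟩) | ⟨⟨⟨⟨e1, e2⟩, e3⟩, e4⟩, hp⟩) | ⟨⟨⟨⟨e1, e2⟩, e3⟩, e4⟩, hp⟩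
  · tauto
  all_goals exact ⟨_, ⟨by simp [e1, PairEdge.only], by simp [e2, PairEdge.only],
    by simp [e3, PairEdge.only], by simp [e4, PairEdge.only]⟩, hp⟩

theorem tripleOk_of_not_obstruction {a b u w u' w' u'' w'' : V} {τ τ' τ'' : PairType}
    {r r' r'' : PairEdge} (ho : ¬ G.HasGrundyObstruction) (hab : G.Adj a b)
    (h : G.HasPairType a b u w τ) (h' : G.HasPairType a b u' w' τ')
    (h'' : G.HasPairType a b u'' w'' τ'') (hr : G.HasPairRel u w u' w' r.only)
    (hr' : G.HasPairRel u w u'' w'' r'.only) (hr'' : G.HasPairRel u' w' u'' w'' r''.only)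
    (hp : pairOk τ τ' r = true) (hp' : pairOk τ τ'' r' = true) (hp'' : pairOk τ' τ'' r'' = true) :
    tripleOk τ τ' τ'' r r' r'' = true := by
  have key := threePairCheck_all
  simp only [PairType.all_iff, PairEdge.all_iff, Bool.or_eq_true] at key
  have k1 := (key τ τ' r).resolve_left (by simp [hp])
  have k2 := (k1 τ'' r').resolve_left (by simp [hp'])
  rcases k2 r'' with (k3 | k3) | k3
  · simp [hp''] at k3
  · exact k3
  · exact absurd (hasGrundyObstruction_of_threePairCheck hab h h' h'' hr hr' hr'' k3) ho

/-- One direction of the adjacency of `pairGraph`. -/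
def pairArc {ℓ : ℕ} (τ : Fin ℓ → PairType) (ρ : Fin ℓ → Fin ℓ → PairEdge) :
    LVertex ℓ → LVertex ℓ → Prop
  | .q₁, .q₂ => True
  | .q₁, .u _ => True
  | .q₁, .w j => (τ j).qw₁ = true
  | .q₂, .u i => (τ i).qu = true
  | .q₂, .w j => (τ j).qw₂ = true
  | .u i, .u j => ρ i j = .uu
  | .u i, .w j => i ≠ j ∧ ρ i j = .uw
  | .w i, .w j => ρ i j = .ww
  | _, _ => False

/-- The graph with the edge `q₁ q₂` in which the pair `u_i, w_i` is attached to it as described by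
`τ i`, and the edge `ρ i j` joins the pairs with the indices `i` and `j`. -/
def pairGraph {ℓ : ℕ} (τ : Fin ℓ → PairType) (ρ : Fin ℓ → Fin ℓ → PairEdge) :
    SimpleGraph (LVertex ℓ) :=
  fromRel (pairArc τ ρ)

/-- The conditions that all two or three pairs of an optimal graph satisfy. -/
structure IsPairStructure {ℓ : ℕ} (τ : Fin ℓ → PairType) (ρ : Fin ℓ → Fin ℓ → PairEdge) :
    Prop where
  flip : ∀ i j, i ≠ j → ρ j i = (ρ i j).flip
  pair : ∀ i j, i ≠ j → pairOk (τ i) (τ j) (ρ i j) = true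
  triple : ∀ i j k, i ≠ j → i ≠ k → j ≠ k →
    tripleOk (τ i) (τ j) (τ k) (ρ i j) (ρ i k) (ρ j k) = true

theorem HasPairRel.flip_eq {u w u' w' : V} {r r' : PairEdge} (h : G.HasPairRel u w u' w' r.only)
    (h' : G.HasPairRel u' w' u w r'.only) : r' = r.flip := by
  obtain ⟨h1, h2, h3, h4⟩ := h
  obtain ⟨k1, k2, k3, k4⟩ := h'
  rw [G.adj_comm] at k1 k2 k3 k4
  rw [h1] at k1
  rw [h2] at k3
  rw [h3] at k2
  rw [h4] at k4
  cases r <;> cases r' <;> simp_all [PairEdge.only, PairEdge.flip]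

theorem HasPairRel.adj_uu {u w u' w' : V} {r : PairEdge} (h : G.HasPairRel u w u' w' r.only) :
    G.Adj u u' ↔ r = .uu := by
  rw [h.uu]; cases r <;> simp [PairEdge.only]

theorem HasPairRel.adj_uw {u w u' w' : V} {r : PairEdge} (h : G.HasPairRel u w u' w' r.only) :
    G.Adj u w' ↔ r = .uw := by
  rw [h.uw]; cases r <;> simp [PairEdge.only]

theorem HasPairRel.adj_ww {u w u' w' : V} {r : PairEdge} (h : G.HasPairRel u w u' w' r.only) :
    G.Adj w w' ↔ r = .ww := by
  rw [h.ww]; cases r <;> simp [PairEdge.only]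

/-- The map from `LVertex ℓ` that is given by its values. -/
def LVertex.elim {ℓ : ℕ} (a b : V) (u w : Fin ℓ → V) : LVertex ℓ → V
  | .u i => u i
  | .w i => w i
  | .q₁ => a
  | .q₂ => b

theorem exists_iso_pairGraph [Finite V] {ℓ : ℕ} (hℓ : 2 ≤ ℓ) (hG : G.IsOptimal (ℓ + 2)) :
    ∃ (τ : Fin ℓ → PairType) (ρ : Fin ℓ → Fin ℓ → PairEdge), IsPairStructure τ ρ ∧
      Nonempty (pairGraph τ ρ ≃g G) := by
  classical
  obtain ⟨-, -, ho, ⟨C, hC⟩, hcard⟩ := (isOptimal_iff (by omega)).mp hG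
  obtain ⟨i₁, i₂, h12, ⟨a, ha⟩, ⟨b, hb⟩, hp⟩ := (hC.card_bound (by omega) ho).2 hcard
  have hab : G.Adj a b := by
    obtain ⟨v, w, hvw, hv, hw⟩ := hC.2 i₁ i₂ h12
    rwa [(ha v).mp hv, (hb w).mp hw] at hvw
  let J : Finset (Fin (ℓ + 2)) := {i₁, i₂}ᶜ
  have hJ : J.card = ℓ := by
    rw [Finset.card_compl, Finset.card_pair h12, Fintype.card_fin]
    omega
  let σ := (J.equivFinOfCardEq hJ).symm
  have hσ : ∀ i, (σ i : Fin (ℓ + 2)) ≠ i₁ ∧ (σ i : Fin (ℓ + 2)) ≠ i₂ := fun i => by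
    have := (σ i).2
    simpa [J] using this
  have hpair : ∀ i : Fin ℓ, ∃ (u w : V) (τ : PairType), u ≠ w ∧
      (∀ v, C v = σ i ↔ v = u ∨ v = w) ∧ G.HasPairType a b u w τ := by
    intro i
    obtain ⟨x, y, hxy, hv⟩ := hp (σ i) (hσ i).1 (hσ i).2
    have nb : ∀ (j : Fin (ℓ + 2)) (c : V), (∀ v, C v = j ↔ v = c) → j ≠ σ i →
        G.Adj c x ∨ G.Adj c y := by
      intro j c hc hj
      obtain ⟨v, w, hvw, hv', hw⟩ := hC.2 j (σ i) hj
      rw [(hc v).mp hv'] at hvw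
      rcases (hv w).mp hw with rfl | rfl
      exacts [Or.inl hvw, Or.inr hvw]
    have hnxy : ¬ G.Adj x y := fun h =>
      C.valid h (((hv x).mpr (Or.inl rfl)).trans ((hv y).mpr (Or.inr rfl)).symm)
    obtain ⟨u, w, τ, huw, hτ⟩ :=
      exists_hasPairType hnxy (nb i₁ a ha (hσ i).1.symm) (nb i₂ b hb (hσ i).2.symm)
    refine ⟨u, w, τ, ?_, fun v => ?_, hτ⟩
    · rcases huw with ⟨rfl, rfl⟩ | ⟨rfl, rfl⟩
      exacts [hxy, hxy.symm]
    · rw [hv]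
      rcases huw with ⟨rfl, rfl⟩ | ⟨rfl, rfl⟩
      exacts [Iff.rfl, or_comm]
  choose u w τ huw hcol hτ using hpair
  have hedge : ∀ i j : Fin ℓ, ∃ r : PairEdge, i ≠ j →
      G.HasPairRel (u i) (w i) (u j) (w j) r.only ∧ pairOk (τ i) (τ j) r = true := by
    intro i j
    by_cases hij : i = j
    -- The diagonal value is arbitrary: `fromRel` discards the loops that it would produce, and
    -- `pairArc` requires `i ≠ j` for an edge `u_i w_j`.
    · exact ⟨.uu, fun h => absurd hij h⟩
    · obtain ⟨x, y, hxy, hx, hy⟩ := hC.2 (σ i) (σ j)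
        (fun h => hij (σ.injective (Subtype.ext h)))
      have : G.Adj (u i) (u j) ∨ G.Adj (u i) (w j) ∨ G.Adj (w i) (u j) ∨ G.Adj (w i) (w j) := by
        rcases (hcol i x).mp hx with rfl | rfl <;> rcases (hcol j y).mp hy with rfl | rfl <;>
          simp [hxy]
      obtain ⟨r, hr⟩ := exists_pairEdge ho hab (hτ i) (hτ j) this
      exact ⟨r, fun _ => hr⟩
  choose ρ hρ using hedge
  have hflip : ∀ i j, i ≠ j → ρ j i = (ρ i j).flip := fun i j hij =>
    (hρ i j hij).1.flip_eq (hρ j i hij.symm).1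
  refine ⟨τ, ρ, ⟨hflip, fun i j hij => (hρ i j hij).2, fun i j k hij hik hjk =>
    tripleOk_of_not_obstruction ho hab (hτ i) (hτ j) (hτ k) (hρ i j hij).1 (hρ i k hik).1
      (hρ j k hjk).1 (hρ i j hij).2 (hρ i k hik).2 (hρ j k hjk).2⟩, ?_⟩
  have hCa : C a = i₁ := (ha a).mpr rfl
  have hCb : C b = i₂ := (hb b).mpr rfl
  have hCu : ∀ i, C (u i) = σ i := fun i => (hcol i _).mpr (Or.inl rfl)
  have hCw : ∀ i, C (w i) = σ i := fun i => (hcol i _).mpr (Or.inr rfl)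
  have hσi : ∀ {i j}, (σ i : Fin (ℓ + 2)) = σ j → i = j := fun h => σ.injective (Subtype.ext h)
  have hbij : Function.Bijective (LVertex.elim a b u w) := by
    constructor
    · intro x y hxy
      have hc := congrArg C hxy
      cases x <;> cases y <;>
        simp only [LVertex.elim, hCa, hCb, hCu, hCw, h12, h12.symm, hσ, (hσ _).1.symm,
          (hσ _).2.symm] at hc hxy ⊢
      · rw [hσi hc]
      · exact absurd ((hσi hc) ▸ hxy) (huw _)
      · exact absurd ((hσi hc) ▸ hxy).symm (huw _)
      · rw [hσi hc]
    · intro v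
      by_cases h1 : C v = i₁
      · exact ⟨.q₁, ((ha v).mp h1).symm⟩
      by_cases h2 : C v = i₂
      · exact ⟨.q₂, ((hb v).mp h2).symm⟩
      · have hσv : (σ (σ.symm ⟨C v, by simp [J, h1, h2]⟩) : Fin (ℓ + 2)) = C v := by simp
        rcases (hcol _ v).mp hσv.symm with h | h
        exacts [⟨.u _, h.symm⟩, ⟨.w _, h.symm⟩]
  refine ⟨⟨Equiv.ofBijective _ hbij, ?_⟩⟩
  have hne : ∀ {x y}, G.Adj (LVertex.elim a b u w x) (LVertex.elim a b u w y) → x ≠ y := by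
    rintro x y hxy rfl
    exact G.loopless.irrefl _ hxy
  have fw : ∀ x y, pairArc τ ρ x y → x ≠ y →
      G.Adj (LVertex.elim a b u w x) (LVertex.elim a b u w y) := by
    intro x y h hxy
    cases x <;> cases y <;> simp only [pairArc, LVertex.elim] at h ⊢
    · exact (hρ _ _ (by rintro rfl; exact hxy rfl)).1.adj_uu.mpr h
    · exact (hρ _ _ h.1).1.adj_uw.mpr h.2
    · exact (hρ _ _ (by rintro rfl; exact hxy rfl)).1.adj_ww.mpr h
    · exact (hτ _).au
    · exact (hτ _).aw.mpr h
    · exact hab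
    · exact (hτ _).bu.mpr h
    · exact (hτ _).bw.mpr h
  have bw : ∀ x y, G.Adj (LVertex.elim a b u w x) (LVertex.elim a b u w y) →
      pairArc τ ρ x y ∨ pairArc τ ρ y x := by
    intro x y h
    have hxy := hne h
    cases x <;> cases y <;> simp only [pairArc, LVertex.elim, or_false, false_or, or_true,
      ne_eq, not_true_eq_false] at h hxy ⊢
    · exact Or.inl ((hρ _ _ (by rintro rfl; exact hxy rfl)).1.adj_uu.mp h)
    · rename_i i j
      have hij : i ≠ j := by
        rintro rfl
        exact (hτ i).uw h
      exact ⟨hij, (hρ _ _ hij).1.adj_uw.mp h⟩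
    · exact (hτ _).bu.mp h.symm
    · rename_i i j
      have hij : j ≠ i := by
        rintro rfl
        exact (hτ j).uw h.symm
      exact ⟨hij, (hρ _ _ hij).1.adj_uw.mp h.symm⟩
    · exact Or.inl ((hρ _ _ (by rintro rfl; exact hxy rfl)).1.adj_ww.mp h)
    · exact (hτ _).aw.mp h.symm
    · exact (hτ _).bw.mp h.symm
    · exact (hτ _).aw.mp h
    · exact (hτ _).bu.mp h
    · exact (hτ _).bw.mp h
  intro x y
  change G.Adj (LVertex.elim a b u w x) (LVertex.elim a b u w y) ↔ (pairGraph τ ρ).Adj x y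
  rw [pairGraph, fromRel_adj]
  exact ⟨fun h => ⟨hne h, bw x y h⟩, fun h => h.2.elim (fun h' => fw x y h' h.1)
    fun h' => (fw y x h' h.1.symm).symm⟩

end PairStructure

/-! ### Invariance under isomorphism -/

section Transport

variable {V : Type u} {W : Type v} {G : SimpleGraph V} {H : SimpleGraph W}

theorem HasGrundyObstruction.of_embedding (f : G ↪g H) (h : G.HasGrundyObstruction) :
    H.HasGrundyObstruction := by
  obtain ⟨p, q, r, s, x, y, z, t, h⟩ := h
  refine ⟨f p, f q, f r, f s, f x, f y, f z, f t, ?_⟩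
  simpa only [f.map_adj_iff] using h

theorem Coloring.IsComplete.of_iso {k : ℕ} (f : H ≃g G) {C : G.Coloring (Fin k)}
    (h : C.IsComplete) : Coloring.IsComplete (C.comp f.toHom) := by
  refine ⟨h.1.comp f.surjective, fun i j hij => ?_⟩
  obtain ⟨v, w, hvw, hv, hw⟩ := h.2 i j hij
  refine ⟨f.symm v, f.symm w, f.symm.map_adj_iff.mpr hvw, ?_, ?_⟩
  · change C (f (f.symm v)) = i
    rw [RelIso.apply_symm_apply, hv]
  · change C (f (f.symm w)) = j
    rw [RelIso.apply_symm_apply, hw]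

theorem IsOptimal.of_iso [Finite V] [Finite W] {h : ℕ} (hh : 4 ≤ h) (f : G ≃g H)
    (hG : G.IsOptimal h) : H.IsOptimal h := by
  rw [isOptimal_iff hh] at hG ⊢
  obtain ⟨h1, h2, h3, ⟨C, hC⟩, h5⟩ := hG
  exact ⟨f.connected_iff.mp h1, fun h => h2 (h.of_hom f.toHom),
    fun h => h3 (h.of_embedding f.symm.toEmbedding), ⟨_, hC.of_iso f.symm⟩,
    (Nat.card_congr f.toEquiv).symm.trans h5⟩

theorem Connected.forall_of_closed (hG : G.Connected) {P : V → Prop}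
    (hP : ∀ v w, G.Adj v w → P v → P w) {v : V} (hv : P v) (w : V) : P w := by
  obtain ⟨p⟩ := hG.preconnected v w
  induction p with
  | nil => exact hv
  | cons h _ ih => exact ih (hP _ _ h hv)

end Transport

theorem LVertex.card (ℓ : ℕ) : Nat.card (LVertex ℓ) = 2 * ℓ + 2 := by
  let e : LVertex ℓ ≃ (Fin ℓ ⊕ Fin ℓ) ⊕ Bool :=
    { toFun := fun x => match x with
        | .u i => .inl (.inl i)
        | .w i => .inl (.inr i)
        | .q₁ => .inr false
        | .q₂ => .inr true
      invFun := fun x => match x with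
        | .inl (.inl i) => .u i
        | .inl (.inr i) => .w i
        | .inr false => .q₁
        | .inr true => .q₂
      left_inv := fun x => by cases x <;> rfl
      right_inv := fun x => by rcases x with (_ | _) | (_ | _) <;> rfl }
  rw [Nat.card_congr e]
  simp
  omega

instance (ℓ : ℕ) : Finite (LVertex ℓ) :=
  Nat.finite_of_card_ne_zero (by rw [LVertex.card]; omega)

/-! ### Pair systems that are bipartite or disconnected -/

section PairGraph

variable {ℓ : ℕ} {τ : Fin ℓ → PairType} {ρ : Fin ℓ → Fin ℓ → PairEdge}

theorem pairGraph_colorable_two (hτ : ∀ i, τ i = .split)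
    (hρ : ∀ i j, i ≠ j → ρ i j = .uw ∨ ρ i j = .wu) : (pairGraph τ ρ).Colorable 2 := by
  let c : LVertex ℓ → Fin 2 := fun x => match x with
    | .u _ => 0
    | .q₂ => 0
    | .w _ => 1
    | .q₁ => 1
  have key : ∀ x y, x ≠ y → pairArc τ ρ x y → c x ≠ c y := by
    intro x y hxy h
    cases x <;> cases y <;> simp only [pairArc, hτ, PairType.qw₁, PairType.qu, PairType.qw₂,
      Bool.false_eq_true, c, ne_eq, zero_ne_one, one_ne_zero, not_false_eq_true] at h ⊢
    all_goals
      rename_i i j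
      rcases hρ i j (by rintro rfl; exact hxy rfl) with h' | h' <;> simp [h] at h'
  exact ⟨Coloring.mk c fun {x y} h => h.2.elim (key x y h.1) fun h' => (key y x h.1.symm h').symm⟩

/-- The vertices `w_i` have no neighbors outside their own set. -/
theorem pairGraph_not_connected (hℓ : 0 < ℓ) (hτ : ∀ i, τ i = .detached)
    (hρ : ∀ i j, i ≠ j → ρ i j = .ww) : ¬ (pairGraph τ ρ).Connected := by
  intro hc
  refine hc.forall_of_closed (P := fun x => ∃ j, x = .w j) (v := .w ⟨0, hℓ⟩) ?_ ⟨_, rfl⟩ .q₁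
    |>.elim fun _ h => by simp at h
  rintro x y ⟨hxy, h⟩ ⟨j, rfl⟩
  cases y with
  | w i => exact ⟨i, rfl⟩
  | u i =>
    rcases h with h | h
    · simp [pairArc] at h
    · obtain ⟨hij, h⟩ := h
      simp [hρ i j hij] at h
  | q₁ => simp [pairArc, hτ, PairType.qw₁] at h
  | q₂ => simp [pairArc, hτ, PairType.qw₂] at h

end PairGraph

theorem exists_third {ℓ : ℕ} (hℓ : 3 ≤ ℓ) (i j : Fin ℓ) : ∃ k, i ≠ k ∧ j ≠ k := by
  by_contra hall
  push Not at hall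
  have h1 : (Finset.univ : Finset (Fin ℓ)).card ≤ ({i, j} : Finset (Fin ℓ)).card :=
    Finset.card_le_card fun k _ => by
      by_cases h : i = k
      · simp [h]
      · simp [hall k h]
  have h2 := Finset.card_le_two (a := i) (b := j)
  rw [Finset.card_fin] at h1
  omega

theorem exists_fourth {ℓ : ℕ} (hℓ : 4 ≤ ℓ) (i j k : Fin ℓ) : ∃ l, i ≠ l ∧ j ≠ l ∧ k ≠ l := by
  by_contra hall
  push Not at hall
  have h1 : (Finset.univ : Finset (Fin ℓ)).card ≤ ({i, j, k} : Finset (Fin ℓ)).card :=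
    Finset.card_le_card fun l _ => by
      by_cases h : i = l
      · simp [h]
      · by_cases h' : j = l
        · simp [h']
        · simp [hall l h h']
  have h2 := Finset.card_le_three (a := i) (b := j) (c := k)
  rw [Finset.card_fin] at h1
  omega

/-! ### The linear order on non-detached pairs -/

section Structure

variable {ℓ : ℕ} {τ : Fin ℓ → PairType} {ρ : Fin ℓ → Fin ℓ → PairEdge}

/-- For non-detached pairs the table lists the six transitive tournaments on three points and omits
the two cyclic ones; the last clause is transitivity. -/
theorem tripleOk_regular : ∀ {τ τ' τ'' : PairType} {r r' r'' : PairEdge},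
    tripleOk τ τ' τ'' r r' r'' = true → τ ≠ .detached → τ' ≠ .detached →
    τ'' ≠ .detached ∧ (r = .uw ∨ r = .wu) ∧ (r = .uw → r'' = .uw → r' = .uw) := by
  decide +kernel

/-- A detached and a non-detached pair occur together only as two detached pairs with one split
pair, where the two detached `w` attach to different vertices of the split pair. -/
theorem tripleOk_irregular : ∀ {τ τ' τ'' : PairType} {r r' r'' : PairEdge},
    tripleOk τ τ' τ'' r r' r'' = true → τ = .detached → τ' ≠ .detached →
    τ'' = .detached ∧ τ' = .split ∧ r' = .ww ∧
      (r = .wu ∧ r'' = .ww ∨ r = .ww ∧ r'' = .uw) := by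
  decide +kernel

theorem pairOk_ne_full {τ τ' : PairType} {r : PairEdge} (h : pairOk τ τ' r = true) :
    τ ≠ .full := by
  cases τ <;> cases τ' <;> simp_all [pairOk]

theorem pairOk_first {τ' : PairType} {r : PairEdge} (h : pairOk .first τ' r = true)
    (hr : r = .uw ∨ r = .wu) : r = .uw := by
  cases τ' <;> cases r <;> simp_all [pairOk]

theorem pairOk_last {τ' : PairType} {r : PairEdge} (h : pairOk .last τ' r = true)
    (hr : r = .uw ∨ r = .wu) : r = .wu := by
  cases τ' <;> cases r <;> simp_all [pairOk]

theorem pairOk_detached {r : PairEdge} (h : pairOk .detached .detached r = true) : r = .ww := by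
  cases r <;> simp_all [pairOk]

/-- In a structure without detached pairs, the pairs are linearly ordered. -/
theorem IsPairStructure.exists_perm (hℓ : 3 ≤ ℓ) (h : IsPairStructure τ ρ)
    (hreg : ∀ i, τ i ≠ .detached) :
    (∀ i j, i ≠ j → ρ i j = .uw ∨ ρ i j = .wu) ∧
    ∃ f : Fin ℓ ≃ Fin ℓ, ∀ i j, i ≠ j → (ρ i j = .uw ↔ f i < f j) := by
  classical
  have htri : ∀ i j k, i ≠ j → i ≠ k → j ≠ k → _ := fun i j k hij hik hjk =>
    tripleOk_regular (h.triple i j k hij hik hjk) (hreg i) (hreg j)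
  have hor : ∀ i j, i ≠ j → ρ i j = .uw ∨ ρ i j = .wu := by
    intro i j hij
    obtain ⟨k, hik, hjk⟩ := exists_third hℓ i j
    exact (htri i j k hij hik hjk).2.1
  refine ⟨hor, ?_⟩
  have hasymm : ∀ i j, i ≠ j → ρ i j = .uw → ρ j i ≠ .uw := by
    intro i j hij e
    simp [h.flip i j hij, e, PairEdge.flip]
  have htot : ∀ i j, i ≠ j → ρ i j ≠ .uw → ρ j i = .uw := by
    intro i j hij e
    rw [h.flip i j hij, (hor i j hij).resolve_left e]
    rfl
  let R : Fin ℓ → Fin ℓ → Prop := fun i j => i ≠ j ∧ ρ i j = .uw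
  have htrans : ∀ i j k, R i j → R j k → R i k := by
    rintro i j k ⟨hij, e1⟩ ⟨hjk, e2⟩
    have hik : i ≠ k := by
      rintro rfl
      exact hasymm i j hij e1 e2
    exact ⟨hik, (htri i j k hij hik hjk).2.2 e1 e2⟩
  -- The position of a pair in the order is the number of its predecessors.
  let D : Fin ℓ → Finset (Fin ℓ) := fun i => Finset.univ.filter fun j => R j i
  have hD : ∀ i, (D i).card < ℓ := by
    intro i
    have : D i ⊂ Finset.univ := by
      rw [Finset.ssubset_univ_iff]
      intro e
      have : i ∈ D i := e ▸ Finset.mem_univ i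
      simp [D, R] at this
    simpa using Finset.card_lt_card this
  have hlt : ∀ i j, R i j → (D i).card < (D j).card := by
    intro i j hij
    refine Finset.card_lt_card ⟨fun k hk => ?_, fun hs => ?_⟩
    · simp only [D, Finset.mem_filter_univ] at hk ⊢
      exact htrans _ _ _ hk hij
    · have : i ∈ D i := hs (by simpa [D] using hij)
      simp [D, R] at this
  let f : Fin ℓ → Fin ℓ := fun i => ⟨(D i).card, hD i⟩
  have hinj : Function.Injective f := by
    intro i j hij
    by_contra hne
    have he : (D i).card = (D j).card := congrArg Fin.val hij
    by_cases e : ρ i j = .uw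
    · exact absurd (hlt i j ⟨hne, e⟩) (by omega)
    · exact absurd (hlt j i ⟨Ne.symm hne, htot i j hne e⟩) (by omega)
  refine ⟨Equiv.ofBijective f (Finite.injective_iff_bijective.mp hinj), fun i j hij => ?_⟩
  constructor
  · exact fun e => hlt i j ⟨hij, e⟩
  · intro hf
    by_contra e
    exact absurd (hlt j i ⟨hij.symm, htot i j hij e⟩) (not_lt.mpr (le_of_lt hf))

end Structure

/-! ### Half graphs with two additional vertices -/

/-- One direction of the adjacency of `halfGraph`. -/
def halfArc {ℓ : ℕ} (α β : Prop) : LVertex ℓ → LVertex ℓ → Prop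
  | .u i, .w j => i < j
  | .q₁, .u _ => True
  | .q₂, .w _ => True
  | .q₁, .q₂ => True
  | .q₁, .w j => α ∧ (j : ℕ) = 0
  | .q₂, .u i => β ∧ (i : ℕ) + 1 = ℓ
  | _, _ => False

/-- The half graph with two additional vertices `q₁` and `q₂`; the edges `q₁ w_1` and `q₂ u_ℓ` are
present if `α` and `β` hold. -/
def halfGraph (ℓ : ℕ) (α β : Prop) : SimpleGraph (LVertex ℓ) :=
  fromRel (halfArc α β)

theorem L₁_eq (h : ℕ) : L₁ h = halfGraph (h - 2) True True := by
  rw [L₁, halfGraph]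
  congr 1
  funext x y
  cases x <;> cases y <;> simp [halfArc, LVertex.BaseEdge, LVertex.ExtraEdge]

theorem L₂_eq (h : ℕ) : L₂ h = halfGraph (h - 2) False True := by
  rw [L₂, halfGraph]
  congr 1
  funext x y
  cases x <;> cases y <;> simp [halfArc, LVertex.BaseEdge]

/-- The permutation of the vertices that reverses the order of the pairs. -/
def LVertex.rev {ℓ : ℕ} : LVertex ℓ → LVertex ℓ
  | .u i => .w i.rev
  | .w i => .u i.rev
  | .q₁ => .q₂
  | .q₂ => .q₁

theorem LVertex.rev_rev {ℓ : ℕ} (x : LVertex ℓ) : x.rev.rev = x := by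
  cases x <;> simp [LVertex.rev]

theorem halfArc_rev {ℓ : ℕ} {α β : Prop} {x y : LVertex ℓ}
    (h : halfArc α β x y ∨ halfArc α β y x) :
    halfArc β α x.rev y.rev ∨ halfArc β α y.rev x.rev := by
  cases x <;> cases y <;> simp only [halfArc, LVertex.rev, or_false, false_or, or_true,
    Fin.rev_lt_rev, Fin.val_rev] at h ⊢ <;>
    first | exact h | exact ⟨h.1, by omega⟩

/-- Reversing the order of the pairs. -/
def halfGraphRev (ℓ : ℕ) (α β : Prop) : halfGraph ℓ α β ≃g halfGraph ℓ β α where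
  toFun := LVertex.rev
  invFun := LVertex.rev
  left_inv := LVertex.rev_rev
  right_inv := LVertex.rev_rev
  map_rel_iff' := by
    intro x y
    change (halfGraph ℓ β α).Adj x.rev y.rev ↔ (halfGraph ℓ α β).Adj x y
    rw [halfGraph, halfGraph, fromRel_adj, fromRel_adj]
    refine and_congr (Function.LeftInverse.injective LVertex.rev_rev).ne_iff
      ⟨fun h => ?_, halfArc_rev⟩
    have := halfArc_rev h
    rwa [LVertex.rev_rev, LVertex.rev_rev] at this

/-- The permutation of the vertices that is induced by a permutation of the pairs. -/
def LVertex.permute {ℓ : ℕ} (f : Fin ℓ ≃ Fin ℓ) : LVertex ℓ ≃ LVertex ℓ where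
  toFun := LVertex.elim .q₁ .q₂ (fun i => .u (f i)) fun i => .w (f i)
  invFun := LVertex.elim .q₁ .q₂ (fun i => .u (f.symm i)) fun i => .w (f.symm i)
  left_inv := fun x => by cases x <;> simp [LVertex.elim]
  right_inv := fun x => by cases x <;> simp [LVertex.elim]

/-! ### Identification of the pair systems with half graphs -/

section Structure

variable {ℓ : ℕ} {τ : Fin ℓ → PairType} {ρ : Fin ℓ → Fin ℓ → PairEdge}

/-- A pair of type `first` precedes every other pair and one of type `last` follows every other
pair. So each type occurs at most once, at the corresponding end, and all other pairs are split. -/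
theorem IsPairStructure.nonempty_iso_halfGraph (hℓ : 3 ≤ ℓ) (h : IsPairStructure τ ρ)
    (hreg : ∀ i, τ i ≠ .detached) :
    Nonempty (pairGraph τ ρ ≃g halfGraph ℓ (∃ i, τ i = .first) (∃ i, τ i = .last)) := by
  obtain ⟨hor, f, hf⟩ := h.exists_perm hℓ hreg
  have hfull : ∀ i, τ i ≠ .full := fun i => by
    obtain ⟨j, hij, -⟩ := exists_third hℓ i i
    exact pairOk_ne_full (h.pair i j hij)
  have hfirst : ∀ i, (τ i).qw₁ = true ↔ (∃ i, τ i = .first) ∧ (f i : ℕ) = 0 := by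
    have aux : ∀ i, τ i = .first → (f i : ℕ) = 0 := by
      intro i hi
      have hj := f.apply_symm_apply ⟨0, by omega⟩
      set j := f.symm ⟨0, by omega⟩
      by_cases hij : i = j
      · rw [hij, hj]
      · have := (hf i j hij).mp (pairOk_first (hi ▸ h.pair i j hij) (hor i j hij))
        rw [hj] at this
        exact absurd this (Nat.not_lt_zero _)
    intro i
    constructor
    · intro hi
      have : τ i = .first := by
        have := hfull i
        cases hτ : τ i <;> simp_all [PairType.qw₁]
      exact ⟨⟨i, this⟩, aux i this⟩
    · rintro ⟨⟨j, hj⟩, hi⟩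
      have : i = j := f.injective (Fin.ext (hi.trans (aux j hj).symm))
      rw [this, hj]
      rfl
  have hlast : ∀ i, (τ i).qu = true ↔ (∃ i, τ i = .last) ∧ (f i : ℕ) + 1 = ℓ := by
    have aux : ∀ i, τ i = .last → (f i : ℕ) + 1 = ℓ := by
      intro i hi
      have hj := f.apply_symm_apply ⟨ℓ - 1, by omega⟩
      set j := f.symm ⟨ℓ - 1, by omega⟩
      by_cases hij : i = j
      · rw [hij, hj]
        exact Nat.sub_add_cancel (by omega)
      · have h1 := pairOk_last (hi ▸ h.pair i j hij) (hor i j hij)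
        have : f j < f i := (hf j i (Ne.symm hij)).mp (by rw [h.flip i j hij, h1]; rfl)
        rw [hj, Fin.lt_def] at this
        have := (f i).2
        simp only at *
        omega
    intro i
    constructor
    · intro hi
      have : τ i = .last := by
        have := hfull i
        have := hreg i
        cases hτ : τ i <;> simp_all [PairType.qu]
      exact ⟨⟨i, this⟩, aux i this⟩
    · rintro ⟨⟨j, hj⟩, hi⟩
      have : i = j := f.injective (Fin.ext (by have := aux j hj; omega))
      rw [this, hj]
      rfl
  have hqw : ∀ i, (τ i).qw₂ = true := by
    intro i
    have := hreg i
    cases hτ : τ i <;> simp_all [PairType.qw₂]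
  refine ⟨⟨LVertex.permute f, ?_⟩⟩
  have key : ∀ x y, x ≠ y → (pairArc τ ρ x y ↔
      halfArc (∃ i, τ i = .first) (∃ i, τ i = .last) (LVertex.permute f x)
        (LVertex.permute f y)) := by
    intro x y hxy
    cases x <;> cases y <;> simp only [pairArc, halfArc, LVertex.permute, LVertex.elim,
      Equiv.coe_fn_mk, hqw, ← hfirst, ← hlast]
    · rename_i i j
      have hij : i ≠ j := by rintro rfl; exact hxy rfl
      rcases hor i j hij with e | e <;> simp [e]
    · rename_i i j
      by_cases hij : i = j
      · simp [hij]
      · simp [hij, hf i j hij]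
    · rename_i i j
      have hij : i ≠ j := by rintro rfl; exact hxy rfl
      rcases hor i j hij with e | e <;> simp [e]
  intro x y
  rw [pairGraph, halfGraph, fromRel_adj, fromRel_adj, (LVertex.permute f).injective.ne_iff]
  exact and_congr_right fun hxy => by rw [key x y hxy, key y x hxy.symm]

/-- If all pairs are detached, four of the `w` form a complete graph, which is an obstruction.
Otherwise one pair is split and all others are detached; any two of these attach to different
vertices of the split pair, which is impossible for three of them. -/
theorem IsPairStructure.regular (hℓ : 4 ≤ ℓ) (h : IsPairStructure τ ρ)
    (ho : ¬ (pairGraph τ ρ).HasGrundyObstruction) (i : Fin ℓ) : τ i ≠ .detached := by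
  intro hi
  by_cases hall : ∀ j, τ j = .detached
  · have hww : ∀ i j, i ≠ j → (pairGraph τ ρ).Adj (.w i) (.w j) := fun i j hij =>
      ⟨by simpa using hij, Or.inl (pairOk_detached (by
        have := h.pair i j hij
        rwa [hall i, hall j] at this))⟩
    obtain ⟨j, hij, -⟩ := exists_third (by omega) i i
    obtain ⟨k, hik, hjk⟩ := exists_third (by omega) i j
    obtain ⟨l, hil, hjl, hkl⟩ := exists_fourth hℓ i j k
    have irr := (pairGraph τ ρ).loopless.irrefl (.w l)
    -- In the complete graph on four vertices one vertex plays all of `x, y, z, t`, and `p = s`.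
    exact ho ⟨.w i, .w j, .w k, .w i, .w l, .w l, .w l, .w l, hww i j hij, hww j k hjk,
      hww k i hik.symm, (pairGraph τ ρ).loopless.irrefl _, hww l i hil.symm, hww l j hjl.symm,
      hww l k hkl.symm, hww l i hil.symm, irr, irr, irr, irr, irr, irr⟩
  · push Not at hall
    obtain ⟨j, hj⟩ := hall
    have hij : i ≠ j := by rintro rfl; exact hj hi
    have hdet : ∀ k, k ≠ j → τ k = .detached := by
      intro k hk
      by_cases hik : i = k
      · rw [← hik, hi]
      · exact (tripleOk_irregular (h.triple i j k hij hik hk.symm) hi hj).1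
    have hrel : ∀ k l, k ≠ j → l ≠ j → k ≠ l →
        ρ k j = .wu ∧ ρ l j = .ww ∨ ρ k j = .ww ∧ ρ l j = .wu := by
      intro k l hk hl hkl
      have := (tripleOk_irregular (h.triple k j l hk hkl hl.symm) (hdet k hk) hj).2.2.2
      rw [h.flip j l hl.symm]
      rcases this with ⟨e, e'⟩ | ⟨e, e'⟩ <;> simp [e, e', PairEdge.flip]
    obtain ⟨k, hik, hjk⟩ := exists_third (by omega) i j
    obtain ⟨l, hil, hjl, hkl⟩ := exists_fourth hℓ i j k
    -- Three detached pairs would need three distinct values among `.wu` and `.ww`.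
    have h1 := hrel i k hij hjk.symm hik
    have h2 := hrel i l hij hjl.symm hil
    have h3 := hrel k l hjk.symm hjl.symm hkl
    rcases h1 with ⟨e1, e2⟩ | ⟨e1, e2⟩ <;> rcases h2 with ⟨e3, e4⟩ | ⟨e3, e4⟩ <;>
      rcases h3 with ⟨e5, e6⟩ | ⟨e5, e6⟩ <;> simp_all

theorem IsPairStructure.iso_L (hℓ : 3 ≤ ℓ) (h : IsPairStructure τ ρ)
    (hreg : ∀ i, τ i ≠ .detached) (h2 : ¬ (pairGraph τ ρ).Colorable 2) :
    Nonempty (pairGraph τ ρ ≃g L₁ (ℓ + 2)) ∨ Nonempty (pairGraph τ ρ ≃g L₂ (ℓ + 2)) := by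
  obtain ⟨e⟩ := h.nonempty_iso_halfGraph hℓ hreg
  have hor := (h.exists_perm hℓ hreg).1
  rw [L₁_eq, L₂_eq, Nat.add_sub_cancel]
  by_cases hα : ∃ i, τ i = .first <;> by_cases hβ : ∃ i, τ i = .last <;>
    simp only [hα, hβ] at e
  · exact Or.inl ⟨e⟩
  · exact Or.inr ⟨e.trans (halfGraphRev ℓ True False)⟩
  · exact Or.inr ⟨e⟩
  · refine absurd (pairGraph_colorable_two (fun i => ?_) hor) h2
    push Not at hα hβ
    obtain ⟨j, hij, -⟩ := exists_third hℓ i i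
    have h1 := hα i
    have h2 := hβ i
    have h3 := hreg i
    have h4 := pairOk_ne_full (h.pair i j hij)
    cases hτ : τ i <;> simp_all

end Structure

/-! ### Half graphs are optimal -/

section HalfGraph

variable {ℓ : ℕ} {α β : Prop}

/-- Each of `p, q, r, s` has a neighbor in the independent set `I` of `x, y, z, t`. The vertices
with a neighbor in `I` induce a graph whose edges all share a vertex (if `q₁` or `q₂` lies in `I`)
or a complete bipartite graph (if neither does). In both, the ends of a walk with three edges are
adjacent. -/
theorem halfGraph_not_obstruction : ¬ (halfGraph ℓ α β).HasGrundyObstruction := by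
  rintro ⟨p, q, r, s, x, y, z, t, pq, qr, rs, ps, xp, yq, zr, ts, xy, xz, xt, yz, yt, zt⟩
  set G := halfGraph ℓ α β with hG
  let I : LVertex ℓ → Prop := fun v => v = x ∨ v = y ∨ v = z ∨ v = t
  have hI : ∀ v w, I v → I w → ¬ G.Adj v w := by
    rintro v w (rfl | rfl | rfl | rfl) (rfl | rfl | rfl | rfl) h <;>
      first | exact G.loopless.irrefl _ h | exact absurd h ‹_› | exact absurd h.symm ‹_›
  have hDp : ∃ v, I v ∧ G.Adj v p := ⟨x, by simp [I], xp⟩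
  have hDq : ∃ v, I v ∧ G.Adj v q := ⟨y, by simp [I], yq⟩
  have hDr : ∃ v, I v ∧ G.Adj v r := ⟨z, by simp [I], zr⟩
  have hDs : ∃ v, I v ∧ G.Adj v s := ⟨t, by simp [I], ts⟩
  clear_value I
  have huu : ∀ i j, ¬ G.Adj (.u i) (.u j) := fun i j => by simp [hG, halfGraph, halfArc]
  have hww : ∀ i j, ¬ G.Adj (.w i) (.w j) := fun i j => by simp [hG, halfGraph, halfArc]
  have huw : ∀ i j, G.Adj (.u i) (.w j) ↔ i < j := fun i j => by simp [hG, halfGraph, halfArc]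
  have hqq : G.Adj .q₁ .q₂ := by simp [hG, halfGraph, halfArc]
  have hq₁u : ∀ i, G.Adj .q₁ (.u i) := fun i => by simp [hG, halfGraph, halfArc]
  have hq₂w : ∀ i, G.Adj .q₂ (.w i) := fun i => by simp [hG, halfGraph, halfArc]
  have hq₁w : ∀ i, G.Adj .q₁ (.w i) → (i : ℕ) = 0 := fun i => by
    simp [hG, halfGraph, halfArc]
  have hq₂u : ∀ i, G.Adj .q₂ (.u i) → (i : ℕ) + 1 = ℓ := fun i => by
    simp [hG, halfGraph, halfArc]
  have irr := G.loopless.irrefl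
  have star : ∀ c : LVertex ℓ, (∀ v w, (∃ a, I a ∧ G.Adj a v) → (∃ a, I a ∧ G.Adj a w) →
      G.Adj v w → v = c ∨ w = c) → False := by
    intro c hc
    rcases hc q r hDq hDr qr with rfl | rfl
    · rcases hc r s hDr hDs rs with rfl | rfl
      · exact irr _ qr
      · exact ps pq
    · rcases hc p q hDp hDq pq with rfl | rfl
      · exact ps rs
      · exact irr _ qr
  by_cases h1 : I .q₁
  · have nu : ∀ i, ¬ I (.u i) := fun i h => hI _ _ h1 h (hq₁u i)
    have nq : ¬ I .q₂ := fun h => hI _ _ h1 h hqq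
    have hDw : ∀ j, (∃ a, I a ∧ G.Adj a (.w j)) → (j : ℕ) = 0 := by
      rintro j ⟨a, ha, haj⟩
      cases a with
      | u i => exact absurd ha (nu i)
      | w i => exact absurd haj (hww _ _)
      | q₁ => exact hq₁w j haj
      | q₂ => exact absurd ha nq
    have hDq₁ : ¬ ∃ a, I a ∧ G.Adj a .q₁ := fun ⟨a, ha, h⟩ => hI _ _ ha h1 h
    -- Only the `u_i`, the first `w` and `q₂` can have a neighbor in `I`, and the first `w` is
    -- adjacent to no `u_i`.
    refine star .q₂ fun v w hv hw hvw => ?_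
    cases v <;> cases w <;> simp only [or_true, true_or, reduceCtorEq, or_self] <;>
      first
      | exact hDq₁ hv
      | exact hDq₁ hw
      | exact huu _ _ hvw
      | exact hww _ _ hvw
      | (have h := (huw _ _).mp hvw; have := hDw _ hw; rw [Fin.lt_def] at h; omega)
      | (have h := (huw _ _).mp hvw.symm; have := hDw _ hv; rw [Fin.lt_def] at h; omega)
  by_cases h2 : I .q₂
  · have nw : ∀ i, ¬ I (.w i) := fun i h => hI _ _ h2 h (hq₂w i)
    have hDu : ∀ i, (∃ a, I a ∧ G.Adj a (.u i)) → (i : ℕ) + 1 = ℓ := by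
      rintro j ⟨a, ha, haj⟩
      cases a with
      | u i => exact absurd haj (huu _ _)
      | w i => exact absurd ha (nw i)
      | q₁ => exact absurd ha h1
      | q₂ => exact hq₂u j haj
    have hDq₂ : ¬ ∃ a, I a ∧ G.Adj a .q₂ := fun ⟨a, ha, h⟩ => hI _ _ ha h2 h
    refine star .q₁ fun v w hv hw hvw => ?_
    cases v <;> cases w <;> simp only [or_true, true_or, reduceCtorEq, or_self] <;>
      first
      | exact hDq₂ hv
      | exact hDq₂ hw
      | exact huu _ _ hvw
      | exact hww _ _ hvw
      | (rename_i i j; have h := (huw i j).mp hvw; have := hDu _ hv; rw [Fin.lt_def] at h; omega)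
      | (rename_i i j; have h := (huw j i).mp hvw.symm; have := hDu _ hw
         rw [Fin.lt_def] at h; omega)
  · have hDu : ∀ i, (∃ a, I a ∧ G.Adj a (.u i)) → ∃ j, I (.w j) ∧ i < j := by
      rintro i ⟨a, ha, hai⟩
      cases a with
      | u j => exact absurd hai (huu _ _)
      | w j => exact ⟨j, ha, (huw _ _).mp hai.symm⟩
      | q₁ => exact absurd ha h1
      | q₂ => exact absurd ha h2
    have hDw : ∀ j, (∃ a, I a ∧ G.Adj a (.w j)) → ∃ i, I (.u i) ∧ i < j := by
      rintro j ⟨a, ha, haj⟩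
      cases a with
      | u i => exact ⟨i, ha, (huw _ _).mp haj⟩
      | w i => exact absurd haj (hww _ _)
      | q₁ => exact absurd ha h1
      | q₂ => exact absurd ha h2
    have hIle : ∀ i j, I (.u i) → I (.w j) → j ≤ i := fun i j hi hj =>
      not_lt.mp fun h => hI _ _ hi hj ((huw i j).mpr h)
    -- The optional edges play no role here: neither the first `w` nor the last `u` has a neighbor
    -- in `I`.
    have nq₁w : ∀ j, (∃ a, I a ∧ G.Adj a (.w j)) → ¬ G.Adj .q₁ (.w j) := by
      intro j hj h
      obtain ⟨i, -, hi⟩ := hDw j hj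
      have := hq₁w j h
      rw [Fin.lt_def] at hi
      omega
    have nq₂u : ∀ i, (∃ a, I a ∧ G.Adj a (.u i)) → ¬ G.Adj .q₂ (.u i) := by
      intro i hi h
      obtain ⟨j, -, hj⟩ := hDu i hi
      have := hq₂u i h
      rw [Fin.lt_def] at hj
      have := j.2
      omega
    let side : LVertex ℓ → Bool := fun v => match v with
      | .q₁ => true
      | .w _ => true
      | .q₂ => false
      | .u _ => false
    have hside : ∀ v w, (∃ a, I a ∧ G.Adj a v) → (∃ a, I a ∧ G.Adj a w) →
        (G.Adj v w ↔ side v ≠ side w) := by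
      -- For `w_{j'}` and `u_{i'}` in `I`, independence gives `j' ≤ i'`, so `i < j' ≤ i' < j`.
      have hlt : ∀ i j, (∃ a, I a ∧ G.Adj a (.u i)) → (∃ a, I a ∧ G.Adj a (.w j)) → i < j := by
        intro i j hi hj
        obtain ⟨j', hj', hij⟩ := hDu i hi
        obtain ⟨i', hi', hij'⟩ := hDw j hj
        exact (hij.trans_le (hIle i' j' hi' hj')).trans hij'
      intro v w hv hw
      cases v <;> cases w <;> simp only [side, ne_eq, not_true_eq_false,
        not_false_eq_true, iff_true, iff_false, Bool.true_eq_false, Bool.false_eq_true] <;>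
        first
        | exact irr _
        | exact huu _ _
        | exact hww _ _
        | exact hqq
        | exact hqq.symm
        | exact hq₁u _
        | exact (hq₁u _).symm
        | exact hq₂w _
        | exact (hq₂w _).symm
        | exact nq₁w _ hw
        | exact fun h => nq₁w _ hv h.symm
        | exact nq₂u _ hw
        | exact fun h => nq₂u _ hv h.symm
        | exact (huw _ _).mpr (hlt _ _ hv hw)
        | exact ((huw _ _).mpr (hlt _ _ hw hv)).symm
    have h1 := (hside p q hDp hDq).mp pq
    have h2 := (hside q r hDq hDr).mp qr
    have h3 := (hside r s hDr hDs).mp rs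
    refine ps ((hside p s hDp hDs).mpr ?_)
    have hb : ∀ a b c d : Bool, a ≠ b → b ≠ c → c ≠ d → a ≠ d := by decide
    exact hb _ _ _ _ h1 h2 h3

/-- Vertices may repeat, so that triangles are covered as well as 5-cycles. -/
theorem not_colorable_two_of_closed_walk {V : Type u} {G : SimpleGraph V} {a b c d e : V}
    (hab : G.Adj a b) (hbc : G.Adj b c) (hcd : G.Adj c d) (hde : G.Adj d e) (hea : G.Adj e a) :
    ¬ G.Colorable 2 := by
  rintro ⟨C⟩
  have h1 := C.valid hab
  have h2 := C.valid hbc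
  have h3 := C.valid hcd
  have h4 := C.valid hde
  have h5 := C.valid hea
  generalize C a = a, C b = b, C c = c, C d = d, C e = e at *
  omega

/-- The complete coloring of `halfGraph` by the pairs and the two additional vertices. -/
def halfColor {ℓ : ℕ} : LVertex ℓ → Fin (ℓ + 2)
  | .u i => i.castAdd 2
  | .w i => i.castAdd 2
  | .q₁ => Fin.natAdd ℓ 0
  | .q₂ => Fin.natAdd ℓ 1

theorem halfGraph_isOptimal (hℓ : 2 ≤ ℓ) : (halfGraph ℓ α True).IsOptimal (ℓ + 2) := by
  rw [isOptimal_iff (by omega)]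
  set G := halfGraph ℓ α True with hG
  have huw : ∀ {i j}, i < j → G.Adj (.u i) (.w j) := fun h => by simp [hG, halfGraph, halfArc, h]
  have hqq : G.Adj .q₁ .q₂ := by simp [hG, halfGraph, halfArc]
  have hq₁u : ∀ i, G.Adj .q₁ (.u i) := fun i => by simp [hG, halfGraph, halfArc]
  have hq₂w : ∀ i, G.Adj .q₂ (.w i) := fun i => by simp [hG, halfGraph, halfArc]
  refine ⟨?_, ?_, halfGraph_not_obstruction, ?_, ?_⟩
  · rw [connected_iff_exists_forall_reachable]
    refine ⟨.q₁, fun v => ?_⟩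
    cases v with
    | u i => exact (hq₁u i).reachable
    | w i => exact hqq.reachable.trans (hq₂w i).reachable
    | q₁ => exact Reachable.refl _
    | q₂ => exact hqq.reachable
  · have hq₂u : G.Adj .q₂ (.u ⟨ℓ - 1, by omega⟩) := by
      simp [hG, halfGraph, halfArc]
      omega
    -- The triangle `q₁ q₂ u_ℓ`, with one edge traversed three times.
    exact not_colorable_two_of_closed_walk hqq hq₂u hq₂u.symm hq₂u (hq₁u _).symm
  · have hu : ∀ i : Fin ℓ, (halfColor (.u i) : ℕ) = i := fun _ => rfl
    have hw : ∀ i : Fin ℓ, (halfColor (.w i) : ℕ) = i := fun _ => rfl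
    have h₁ : (halfColor (.q₁ : LVertex ℓ) : ℕ) = ℓ := rfl
    have h₂ : (halfColor (.q₂ : LVertex ℓ) : ℕ) = ℓ + 1 := rfl
    have key : ∀ v w, G.Adj v w → halfColor v ≠ halfColor w := by
      intro v w h he
      have he := congrArg Fin.val he
      have h := h.2
      cases v <;> cases w <;> simp only [halfArc, or_self, or_false, false_or, Fin.lt_def] at h <;>
        simp only [hu, hw, h₁, h₂] at he <;>
        omega
    refine ⟨Coloring.mk halfColor fun {v w} h => key v w h, ?_, ?_⟩
    · intro i
      refine Fin.addCases (fun i => ⟨.u i, rfl⟩) (fun i => ?_) i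
      fin_cases i
      exacts [⟨.q₁, rfl⟩, ⟨.q₂, rfl⟩]
    · have hall : ∀ i j : Fin (ℓ + 2), i < j → ∃ v w, G.Adj v w ∧ halfColor v = i ∧
          halfColor w = j := by
        intro i j
        refine Fin.addCases (fun i => ?_) (fun i => ?_) i <;>
          refine Fin.addCases (fun j => ?_) (fun j => ?_) j
        · exact fun h => ⟨.u i, .w j, huw (h), rfl, rfl⟩
        · intro _
          fin_cases j
          exacts [⟨.u i, .q₁, (hq₁u i).symm, rfl, rfl⟩, ⟨.w i, .q₂, (hq₂w i).symm, rfl, rfl⟩]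
        · intro h
          simp [Fin.lt_def] at h
          omega
        · intro h
          fin_cases i <;> fin_cases j <;> simp [Fin.lt_def] at h
          exact ⟨.q₁, .q₂, hqq, rfl, rfl⟩
      intro i j hij
      rcases lt_or_gt_of_ne hij with h | h
      · exact hall i j h
      · obtain ⟨v, w, hvw, hv, hw⟩ := hall j i h
        exact ⟨w, v, hvw.symm, hw, hv⟩
  · rw [LVertex.card]
    omega

end HalfGraph

/-! ### Verification of the explicit small graphs -/

section Search

variable {n : ℕ}

theorem search_of_hasGrundyObstruction {α : Type*} {L : List α} {G : SimpleGraph α}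
    {m : α → α → Bool} (hL : ∀ x, x ∈ L) (h : ∀ x y, G.Adj x y ↔ m x y = true)
    (ho : G.HasGrundyObstruction) : searchObstruction L m = true := by
  obtain ⟨p, q, r, s, x, y, z, t, h1, h2, h3, h4, h5, h6, h7, h8, h9, h10, h11, h12, h13, h14⟩ := ho
  rw [h] at h1 h2 h3 h4 h5 h6 h7 h8 h9 h10 h11 h12 h13 h14
  rw [Bool.not_eq_true] at h4 h9 h10 h11 h12 h13 h14
  simp only [searchObstruction, List.any_eq_true, Bool.and_eq_true, Bool.not_eq_true']
  exact ⟨q, hL q, r, hL r, h2, p, hL p, h1, s, hL s, ⟨h3, h4⟩, x, hL x, h5, y, hL y, ⟨h6, h9⟩,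
    z, hL z, ⟨⟨h7, h10⟩, h12⟩, t, hL t, ⟨⟨h8, h11⟩, h13⟩, h14⟩

/-- The adjacency of `ofEdgeList`. -/
def listAdj (E : List (Fin n × Fin n)) (x y : Fin n) : Bool :=
  !(x == y) && (E.contains (x, y) || E.contains (y, x))

theorem ofEdgeList_adj (E : List (Fin n × Fin n)) (x y : Fin n) :
    (ofEdgeList E).Adj x y ↔ listAdj E x y = true := by
  simp [ofEdgeList, listAdj]

/-- A test for the defining properties of an optimal graph, apart from the order; the search for
paths and closed walks is limited to those of length three and five, respectively. -/
def optimalCheck {h : ℕ} (m : Fin (n + 1) → Fin (n + 1) → Bool) (c : Fin (n + 1) → Fin h) : Bool :=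
  let L := List.finRange (n + 1)
  (L.all fun v => L.any fun x => (x == 0 || m 0 x) && L.any fun y => (x == y || m x y) &&
    (y == v || m y v)) &&
  (L.any fun a => L.any fun b => m a b && L.any fun c => m b c && L.any fun d => m c d &&
    L.any fun e => m d e && m e a) &&
  !searchObstruction L m &&
  (L.all fun x => L.all fun y => !m x y || !(c x == c y)) &&
  ((List.finRange h).all fun i => L.any fun x => c x == i) &&
  ((List.finRange h).all fun i => (List.finRange h).all fun j => i == j ||
    L.any fun x => c x == i && L.any fun y => m x y && c y == j)

theorem isOptimal_of_check {h : ℕ} (hh : 4 ≤ h) (hn : n + 1 = 2 * h - 2)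
    {G : SimpleGraph (Fin (n + 1))} {m : Fin (n + 1) → Fin (n + 1) → Bool}
    (hG : ∀ x y, G.Adj x y ↔ m x y = true) (c : Fin (n + 1) → Fin h)
    (hc : optimalCheck m c = true) : G.IsOptimal h := by
  simp only [optimalCheck, Bool.and_eq_true, Bool.or_eq_true, List.all_eq_true, List.any_eq_true,
    List.mem_finRange, true_and, forall_true_left, beq_iff_eq, Bool.not_eq_true', ← hG] at hc
  obtain ⟨⟨⟨⟨⟨h1, a, b, ab, x, bx, d, xd, e, de, ea⟩, h3⟩, h4⟩, h5⟩, h6⟩ := hc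
  rw [isOptimal_iff hh]
  refine ⟨?_, not_colorable_two_of_closed_walk ab bx xd de ea, fun ho => ?_,
    ⟨Coloring.mk c fun {x y} hxy he => ?_, h5, fun i j hij => ?_⟩, by simpa using hn⟩
  · rw [connected_iff_exists_forall_reachable]
    have aux : ∀ {x y}, x = y ∨ G.Adj x y → G.Reachable x y := by
      rintro x y (rfl | hxy)
      exacts [Reachable.refl _, hxy.reachable]
    refine ⟨0, fun v => ?_⟩
    obtain ⟨x, hx, y, hy, hv⟩ := h1 v
    exact (aux (hx.imp_left Eq.symm)).trans ((aux hy).trans (aux hv))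
  · rw [search_of_hasGrundyObstruction (List.mem_finRange) hG ho] at h3
    exact absurd h3 (by decide)
  · have := h4 x y
    rw [← Bool.not_eq_true, ← hG, ← Bool.not_eq_true, beq_iff_eq] at this
    exact this.elim (fun h => h hxy) fun h => h he
  · obtain ⟨x, hx, y, hxy, hy⟩ := (h6 i j).resolve_left hij
    exact ⟨x, y, hxy, hx, hy⟩

theorem L₀_isOptimal : L₀.IsOptimal 5 :=
  isOptimal_of_check (by omega) (by omega) (ofEdgeList_adj _) ![0, 1, 2, 3, 2, 3, 4, 4]
    (by decide +kernel)

/-- The edges of the graphs `fourOptimal`. -/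
def fourEdges : Fin 7 → List (Fin 6 × Fin 6) :=
  ![[(0, 1), (3, 5), (0, 2), (1, 2), (0, 4), (1, 5)],
    [(0, 1), (3, 5), (0, 2), (1, 2), (0, 4), (1, 4), (1, 5)],
    [(0, 1), (3, 5), (0, 3), (1, 2), (0, 5), (1, 4)],
    [(0, 1), (3, 5), (0, 3), (1, 2), (0, 4), (1, 4), (1, 5)],
    [(0, 1), (3, 5), (0, 2), (1, 3), (0, 4), (1, 4), (1, 5)],
    [(0, 1), (3, 5), (0, 2), (1, 2), (1, 3), (0, 4), (1, 4), (1, 5)],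
    [(0, 1), (3, 5), (0, 2), (1, 2), (1, 3), (0, 4), (1, 4), (0, 5)]]

theorem fourOptimal_eq (k : Fin 7) : fourOptimal k = ofEdgeList (fourEdges k) := by
  fin_cases k <;> rfl

theorem fourOptimal_adj (k : Fin 7) (x y : Fin 6) :
    (fourOptimal k).Adj x y ↔ listAdj (fourEdges k) x y = true := by
  rw [fourOptimal_eq, ofEdgeList_adj]

theorem fourOptimal_isOptimal (k : Fin 7) : (fourOptimal k).IsOptimal 4 := by
  refine isOptimal_of_check (by omega) (by omega) (fourOptimal_adj k) ![0, 1, 2, 2, 3, 3] ?_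
  revert k
  decide +kernel

end Search

/-! ### Classification for three pairs and for two pairs -/

section Small

theorem nonempty_iso_L₀ {τ : Fin 3 → PairType} {ρ : Fin 3 → Fin 3 → PairEdge}
    (h : IsPairStructure τ ρ) {i j k : Fin 3} (hij : i ≠ j) (hik : i ≠ k) (hjk : j ≠ k)
    (hi : τ i = .detached) (hj : τ j = .detached) (hk : τ k = .split) (eij : ρ i j = .ww)
    (eik : ρ i k = .wu) (ejk : ρ j k = .ww) : Nonempty (pairGraph τ ρ ≃g L₀) := by
  have eji : ρ j i = .ww := by rw [h.flip i j hij, eij]; rfl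
  have eki : ρ k i = .uw := by rw [h.flip i k hik, eik]; rfl
  have ekj : ρ k j = .ww := by rw [h.flip j k hjk, ejk]; rfl
  let f : Fin 8 → LVertex 3 := ![.q₁, .q₂, .u i, .u j, .w i, .w j, .u k, .w k]
  have hinj : Function.Injective f := by
    intro a b hab
    fin_cases a <;> fin_cases b <;> simp [f, hij, hik, hjk, hij.symm, hik.symm, hjk.symm] at hab ⊢
  have hbij : Function.Bijective f :=
    (Nat.bijective_iff_injective_and_card f).mpr ⟨hinj, by rw [LVertex.card]; simp⟩
  refine ⟨(RelIso.symm ⟨Equiv.ofBijective f hbij, ?_⟩ : pairGraph τ ρ ≃g L₀)⟩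
  intro a b
  change (pairGraph τ ρ).Adj (f a) (f b) ↔ L₀.Adj a b
  fin_cases a <;> fin_cases b <;>
    simp [f, pairGraph, pairArc, L₀, ofEdgeList, hij, hik, hjk, hij.symm, hik.symm, hjk.symm, hi,
      hj, hk, eij, eik, ejk, eji, eki, ekj, PairType.qu, PairType.qw₁, PairType.qw₂]

theorem IsPairStructure.iso_of_three {τ : Fin 3 → PairType} {ρ : Fin 3 → Fin 3 → PairEdge}
    (h : IsPairStructure τ ρ) (hG : (pairGraph τ ρ).IsOptimal 5) :
    Nonempty (pairGraph τ ρ ≃g L₀) ∨ Nonempty (pairGraph τ ρ ≃g L₁ 5) ∨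
      Nonempty (pairGraph τ ρ ≃g L₂ 5) := by
  obtain ⟨hc, h2, -⟩ := (isOptimal_iff (by omega)).mp hG
  by_cases hreg : ∀ i, τ i ≠ .detached
  · exact Or.inr (h.iso_L le_rfl hreg h2)
  left
  push Not at hreg
  obtain ⟨i, hi⟩ := hreg
  by_cases hall : ∀ j, τ j = .detached
  · refine absurd hc (pairGraph_not_connected (by omega) hall fun i j hij => ?_)
    have := h.pair i j hij
    rw [hall i, hall j] at this
    exact pairOk_detached this
  push Not at hall
  obtain ⟨j, hj⟩ := hall
  have hij : i ≠ j := by rintro rfl; exact hj hi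
  obtain ⟨k, hik, hjk⟩ := exists_third le_rfl i j
  -- The two alternatives differ by exchanging the detached pairs `i` and `k`; `j` is the split
  -- pair.
  obtain ⟨hk, hjs, eik, ⟨e, e'⟩ | ⟨e, e'⟩⟩ :=
    tripleOk_irregular (h.triple i j k hij hik hjk) hi hj
  · refine nonempty_iso_L₀ h hik hij hjk.symm hi hk hjs eik e ?_
    rw [h.flip j k hjk, e']
    rfl
  · refine nonempty_iso_L₀ h hik.symm hjk.symm hij hk hi hjs ?_ ?_ e
    · rw [h.flip i k hik, eik]
      rfl
    · rw [h.flip j k hjk, e']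
      rfl

/-- The permutations of the vertices of a configuration with two pairs that preserve the pairs. -/
def pairPerm (b₁ b₂ b₃ b₄ : Bool) : Equiv.Perm (Fin 6) :=
  (if b₁ then Equiv.swap 0 1 else 1) * (if b₂ then Equiv.swap 2 4 * Equiv.swap 3 5 else 1) *
    (if b₃ then Equiv.swap 2 3 else 1) * if b₄ then Equiv.swap 4 5 else 1

/-- The adjacency of a configuration with two pairs. -/
def sixAdj (τ τ' : PairType) (r : PairEdge) (x y : Fin 6) : Bool :=
  let s : Fin 6 → Eight := ![.q₁, .q₂, .u, .w, .u', .w']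
  let m := Eight.arc τ τ' .split r.only (fun _ => false) (fun _ => false)
  m (s x) (s y) || m (s y) (s x)

/-- The first two alternatives are the disconnected and the bipartite configurations. Every other
one becomes one of the seven graphs under the sixteen symmetries that preserve the edge `q₁ q₂` and
the partition into pairs. -/
theorem pairOk_iso : ∀ (τ τ' : PairType) (r : PairEdge), pairOk τ τ' r = true →
    (τ = .detached ∧ τ' = .detached) ∨ (τ = .split ∧ τ' = .split ∧ (r = .uw ∨ r = .wu)) ∨
      ∃ (k : Fin 7) (b₁ b₂ b₃ b₄ : Bool), ∀ x y : Fin 6,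
        sixAdj τ τ' r (pairPerm b₁ b₂ b₃ b₄ x) (pairPerm b₁ b₂ b₃ b₄ y) =
          listAdj (fourEdges k) x y := by
  decide +kernel

theorem IsPairStructure.iso_of_two {τ : Fin 2 → PairType} {ρ : Fin 2 → Fin 2 → PairEdge}
    (h : IsPairStructure τ ρ) (hG : (pairGraph τ ρ).IsOptimal 4) :
    ∃ k, Nonempty (pairGraph τ ρ ≃g fourOptimal k) := by
  obtain ⟨hc, h2, -⟩ := (isOptimal_iff (by omega)).mp hG
  have e10 : ρ 1 0 = (ρ 0 1).flip := h.flip 0 1 (by decide)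
  have hp := h.pair 0 1 (by decide)
  rcases pairOk_iso _ _ _ hp with ⟨h0, h1⟩ | ⟨h0, h1, hr⟩ | ⟨k, b₁, b₂, b₃, b₄, hk⟩
  · have e01 : ρ 0 1 = .ww := by
      rw [h0, h1] at hp
      exact pairOk_detached hp
    refine absurd hc (pairGraph_not_connected (by omega) ?_ ?_)
    · intro i; fin_cases i <;> assumption
    · intro i j hij
      rw [e01] at e10
      fin_cases i <;> fin_cases j <;> first | exact absurd rfl hij | exact e01 | exact e10
  · refine absurd (pairGraph_colorable_two ?_ ?_) h2
    · intro i; fin_cases i <;> assumption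
    · intro i j hij
      have hr' : ρ 1 0 = .uw ∨ ρ 1 0 = .wu := by
        rw [e10]
        rcases hr with e | e <;> simp [e, PairEdge.flip]
      fin_cases i <;> fin_cases j <;> first | exact absurd rfl hij | exact hr | exact hr'
  · let f : Fin 6 → LVertex 2 := ![.q₁, .q₂, .u 0, .w 0, .u 1, .w 1]
    have hinj : Function.Injective f := by
      intro a b hab
      fin_cases a <;> fin_cases b <;> simp [f] at hab ⊢
    have hbij : Function.Bijective f :=
      (Nat.bijective_iff_injective_and_card f).mpr ⟨hinj, by rw [LVertex.card]; simp⟩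
    have hadj : ∀ a b, (pairGraph τ ρ).Adj (f a) (f b) ↔ sixAdj (τ 0) (τ 1) (ρ 0 1) a b = true := by
      intro a b
      cases hr : ρ 0 1 <;> rw [hr] at e10 <;> fin_cases a <;> fin_cases b <;>
        simp [f, pairGraph, pairArc, sixAdj, Eight.arc, hr, e10, PairEdge.only, PairEdge.flip]
    let σ := pairPerm b₁ b₂ b₃ b₄
    refine ⟨k, ⟨RelIso.symm ⟨σ.trans (Equiv.ofBijective f hbij), ?_⟩⟩⟩
    intro a b
    change (pairGraph τ ρ).Adj (f (σ a)) (f (σ b)) ↔ (fourOptimal k).Adj a b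
    rw [hadj, fourOptimal_adj, hk]

end Small

/-! ### Extremal graphs and their number -/

section Extremal

variable {V : Type u} {W : Type v} {G : SimpleGraph V}

theorem L₁_isOptimal {h : ℕ} (hh : 4 ≤ h) : (L₁ h).IsOptimal h := by
  obtain ⟨ℓ, rfl⟩ := Nat.exists_eq_add_of_le' (by omega : 2 ≤ h)
  rw [L₁_eq]
  exact halfGraph_isOptimal (by omega)

theorem L₂_isOptimal {h : ℕ} (hh : 4 ≤ h) : (L₂ h).IsOptimal h := by
  obtain ⟨ℓ, rfl⟩ := Nat.exists_eq_add_of_le' (by omega : 2 ≤ h)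
  rw [L₂_eq]
  exact halfGraph_isOptimal (by omega)

/-- A copy of an optimal graph on an initial segment. -/
theorem exists_fin_iso [Finite V] (G : SimpleGraph V) :
    ∃ H : SimpleGraph (Fin (Nat.card V)), Nonempty (G ≃g H) :=
  ⟨_, ⟨Iso.map (Finite.equivFin V) G⟩⟩

/-- The graph `L₂ h` attains the lower bound, so the minimum order is `2h - 2`. -/
theorem isExtremalFor_iff [Finite V] {h : ℕ} (hh : 4 ≤ h) :
    G.IsExtremalFor 3 3 h ↔ G.IsOptimal h := by
  constructor
  · rintro ⟨hG, hmin⟩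
    obtain ⟨H, ⟨e⟩⟩ := exists_fin_iso (L₂ h)
    have hH := (L₂_isOptimal hh).of_iso hh e
    have h1 := hmin _ H hH.1
    rw [(L₂_isOptimal hh).2] at h1
    exact ⟨hG, le_antisymm h1 (hG.le_card hh)⟩
  · rintro ⟨hG, hcard⟩
    refine ⟨hG, fun m H hH => ?_⟩
    have := hH.le_card hh
    rw [Nat.card_fin] at this
    omega

theorem isOptimal_four_iff [Finite V] : G.IsOptimal 4 ↔ ∃ k, Nonempty (G ≃g fourOptimal k) := by
  constructor
  · intro hG
    obtain ⟨τ, ρ, hτ, ⟨e⟩⟩ := exists_iso_pairGraph le_rfl hG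
    obtain ⟨k, ⟨e'⟩⟩ := hτ.iso_of_two (hG.of_iso le_rfl e.symm)
    exact ⟨k, ⟨e.symm.trans e'⟩⟩
  · rintro ⟨k, ⟨e⟩⟩
    exact (fourOptimal_isOptimal k).of_iso le_rfl e.symm

theorem isOptimal_five_iff [Finite V] : G.IsOptimal 5 ↔
    Nonempty (G ≃g L₀) ∨ Nonempty (G ≃g L₁ 5) ∨ Nonempty (G ≃g L₂ 5) := by
  constructor
  · intro hG
    obtain ⟨τ, ρ, hτ, ⟨e⟩⟩ := exists_iso_pairGraph (by omega) hG
    exact (hτ.iso_of_three (hG.of_iso (by omega) e.symm)).imp (Nonempty.map e.symm.trans)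
      (Or.imp (Nonempty.map e.symm.trans) (Nonempty.map e.symm.trans))
  · rintro (⟨⟨e⟩⟩ | ⟨⟨e⟩⟩ | ⟨⟨e⟩⟩)
    · exact L₀_isOptimal.of_iso (by omega) e.symm
    · exact (L₁_isOptimal (by omega)).of_iso (by omega) e.symm
    · exact (L₂_isOptimal (by omega)).of_iso (by omega) e.symm

theorem isOptimal_iff_iso_L [Finite V] {h : ℕ} (hh : 6 ≤ h) : G.IsOptimal h ↔
    Nonempty (G ≃g L₁ h) ∨ Nonempty (G ≃g L₂ h) := by
  constructor
  · intro hG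
    obtain ⟨ℓ, rfl⟩ := Nat.exists_eq_add_of_le' (by omega : 2 ≤ h)
    obtain ⟨τ, ρ, hτ, ⟨e⟩⟩ := exists_iso_pairGraph (by omega) hG
    obtain ⟨-, h2, ho, -⟩ := (isOptimal_iff (by omega)).mp (hG.of_iso (by omega) e.symm)
    exact (hτ.iso_L (by omega) (hτ.regular (by omega) ho) h2).imp (Nonempty.map e.symm.trans)
      (Nonempty.map e.symm.trans)
  · rintro (⟨⟨e⟩⟩ | ⟨⟨e⟩⟩)
    · exact (L₁_isOptimal (by omega)).of_iso (by omega) e.symm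
    · exact (L₂_isOptimal (by omega)).of_iso (by omega) e.symm

theorem exists_extremalGraph_iso [Finite V] {h : ℕ} (hh : 4 ≤ h) (hG : G.IsOptimal h) :
    ∃ p : ExtremalGraph 3 3 h, Nonempty (p.1.2 ≃g G) := by
  obtain ⟨H, ⟨e⟩⟩ := exists_fin_iso G
  exact ⟨⟨⟨_, H⟩, (isExtremalFor_iff hh).mpr (hG.of_iso hh e)⟩, ⟨e.symm⟩⟩

/-- A list of pairwise non-isomorphic representatives that meets every class is a bijection onto the
quotient. -/
theorem numExtremal_eq {f g h m : ℕ} (F : Fin m → ExtremalGraph f g h)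
    (hinj : ∀ k l, Nonempty ((F k).1.2 ≃g (F l).1.2) → k = l)
    (hsurj : ∀ p : ExtremalGraph f g h, ∃ k, Nonempty (p.1.2 ≃g (F k).1.2)) :
    numExtremal f g h = m := by
  have hbij : Function.Bijective fun k => Quotient.mk (extremalSetoid f g h) (F k) := by
    constructor
    · intro k l hkl
      exact hinj k l (Quotient.exact hkl)
    · intro q
      obtain ⟨p, rfl⟩ := Quotient.exists_rep q
      obtain ⟨k, ⟨e⟩⟩ := hsurj p
      exact ⟨k, Quotient.sound ⟨e.symm⟩⟩
  rw [numExtremal, ← Nat.card_congr (Equiv.ofBijective _ hbij), Nat.card_fin]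

/-- The number of walks of length three. -/
def walkCount [Fintype V] (G : SimpleGraph V) [DecidableRel G.Adj] : ℕ :=
  ∑ a, ∑ b, ∑ c, ∑ d, if G.Adj a b ∧ G.Adj b c ∧ G.Adj c d then 1 else 0

theorem Iso.walkCount_eq [Fintype V] [Fintype W] [DecidableRel G.Adj] {H : SimpleGraph W}
    [DecidableRel H.Adj] (e : G ≃g H) : G.walkCount = H.walkCount := by
  rw [walkCount, walkCount, ← e.toEquiv.sum_comp]
  refine Finset.sum_congr rfl fun a _ => ?_
  rw [← e.toEquiv.sum_comp]
  refine Finset.sum_congr rfl fun b _ => ?_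
  rw [← e.toEquiv.sum_comp]
  refine Finset.sum_congr rfl fun c _ => ?_
  rw [← e.toEquiv.sum_comp]
  refine Finset.sum_congr rfl fun d _ => ?_
  refine if_congr ?_ rfl rfl
  change _ ↔ H.Adj (e a) (e b) ∧ H.Adj (e b) (e c) ∧ H.Adj (e c) (e d)
  rw [e.map_adj_iff, e.map_adj_iff, e.map_adj_iff]

instance (k : Fin 7) : DecidableRel (fourOptimal k).Adj := fun x y =>
  decidable_of_iff' _ (fourOptimal_adj k x y)

/-- The numbers of walks of length three are pairwise distinct. -/
theorem fourOptimal_injective {k l : Fin 7} (h : Nonempty (fourOptimal k ≃g fourOptimal l)) :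
    k = l := by
  obtain ⟨e⟩ := h
  have hw : ∀ k, (fourOptimal k).walkCount = ![64, 100, 62, 96, 98, 142, 136] k := by
    decide +kernel
  have := e.walkCount_eq
  rw [hw, hw] at this
  clear e hw
  revert this
  revert k l
  decide

/-- On the same vertex set, `L₂ h` is a proper subgraph of `L₁ h`, so the edge numbers differ. -/
theorem L₁_not_iso_L₂ {h : ℕ} (hh : 4 ≤ h) : IsEmpty (L₁ h ≃g L₂ h) := by
  refine ⟨fun e => ?_⟩
  let D (G : SimpleGraph (LVertex (h - 2))) : Set (LVertex (h - 2) × LVertex (h - 2)) :=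
    {x | G.Adj x.1 x.2}
  have hD : (D (L₁ h)).ncard = (D (L₂ h)).ncard := by
    refine Set.ncard_congr (fun x _ => (e x.1, e x.2)) (fun x hx => e.map_adj_iff.mpr hx) ?_ ?_
    · intro x y _ _ hxy
      exact Prod.ext (e.injective (congrArg Prod.fst hxy)) (e.injective (congrArg Prod.snd hxy))
    · intro y hy
      exact ⟨(e.symm y.1, e.symm y.2), e.symm.map_adj_iff.mpr hy, by simp⟩
  have hlt : D (L₂ h) ⊂ D (L₁ h) := by
    refine ⟨fun x hx => ⟨hx.1, hx.2.imp Or.inl Or.inl⟩, fun hs => ?_⟩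
    have h1 : (L₁ h).Adj .q₁ (.w ⟨0, by omega⟩) := by simp [L₁, LVertex.ExtraEdge]
    have h2 : (L₂ h).Adj .q₁ (.w ⟨0, by omega⟩) := @hs (_, _) h1
    simp [L₂, LVertex.BaseEdge] at h2
  exact absurd (Set.ncard_lt_ncard hlt (Set.toFinite _)) (by omega)

/-- In the half graph `q₂` has at least five neighbors, whereas no degree in `L₀` exceeds four. -/
theorem halfGraph_not_iso_L₀ {α : Prop} : IsEmpty (halfGraph 3 α True ≃g L₀) := by
  refine ⟨fun e => ?_⟩
  have hdeg : ∀ x : Fin 8, (Finset.univ.filter fun y => listAdj [(0, 1), (0, 2), (0, 3), (1, 2),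
      (1, 3), (4, 5), (4, 6), (5, 7), (0, 6), (1, 7)] x y = true).card ≤ 4 := by
    decide +kernel
  let f : Fin 5 → LVertex 3 := ![.q₁, .w 0, .w 1, .w 2, .u 2]
  have hinj : Function.Injective f := by
    intro a b hab
    fin_cases a <;> fin_cases b <;> simp [f] at hab ⊢
  have hf : ∀ a, (halfGraph 3 α True).Adj .q₂ (f a) := by
    intro a
    fin_cases a <;> simp [f, halfGraph, halfArc]
  refine absurd ((Finset.card_le_card_of_injOn (s := Finset.univ) (fun a => e (f a)) (fun a _ => ?_)
    (e.injective.comp hinj).injOn).trans (hdeg (e .q₂))) (by simp)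
  simp only [Finset.coe_filter, Finset.mem_univ, true_and, Set.mem_ofPred_eq]
  exact (ofEdgeList_adj _ _ _).mp (e.map_adj_iff.mpr (hf a))

theorem numExtremal_four : numExtremal 3 3 4 = 7 := by
  choose F hF using fun k => exists_extremalGraph_iso le_rfl (fourOptimal_isOptimal k)
  refine numExtremal_eq F (fun k l ⟨e⟩ => ?_) fun p => ?_
  · obtain ⟨ek⟩ := hF k
    obtain ⟨el⟩ := hF l
    exact fourOptimal_injective ⟨ek.symm.trans (e.trans el)⟩
  · obtain ⟨k, ⟨e⟩⟩ := isOptimal_four_iff.mp ((isExtremalFor_iff le_rfl).mp p.2)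
    exact ⟨k, (hF k).map fun ek => e.trans ek.symm⟩

theorem numExtremal_five : numExtremal 3 3 5 = 3 := by
  obtain ⟨p₀, ⟨e₀⟩⟩ := exists_extremalGraph_iso (by omega) L₀_isOptimal
  obtain ⟨p₁, ⟨e₁⟩⟩ := exists_extremalGraph_iso (by omega) (L₁_isOptimal (h := 5) (by omega))
  obtain ⟨p₂, ⟨e₂⟩⟩ := exists_extremalGraph_iso (by omega) (L₂_isOptimal (h := 5) (by omega))
  have n12 := L₁_not_iso_L₂ (h := 5) (by omega)
  have n10 : IsEmpty (L₁ 5 ≃g L₀) := by rw [L₁_eq]; exact halfGraph_not_iso_L₀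
  have n20 : IsEmpty (L₂ 5 ≃g L₀) := by rw [L₂_eq]; exact halfGraph_not_iso_L₀
  refine numExtremal_eq ![p₀, p₁, p₂] ?_ fun p => ?_
  · rintro k l ⟨e⟩
    fin_cases k <;> fin_cases l <;> first
      | rfl
      | exact (n10.false (e₁.symm.trans (RelIso.trans e.symm e₀))).elim
      | exact (n20.false (e₂.symm.trans (RelIso.trans e.symm e₀))).elim
      | exact (n12.false (e₁.symm.trans (RelIso.trans e.symm e₂))).elim
      | exact (n10.false (e₁.symm.trans (RelIso.trans e e₀))).elim
      | exact (n20.false (e₂.symm.trans (RelIso.trans e e₀))).elim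
      | exact (n12.false (e₁.symm.trans (RelIso.trans e e₂))).elim
  · rcases isOptimal_five_iff.mp ((isExtremalFor_iff (by omega)).mp p.2) with
      ⟨⟨e⟩⟩ | ⟨⟨e⟩⟩ | ⟨⟨e⟩⟩
    exacts [⟨0, ⟨e.trans e₀.symm⟩⟩, ⟨1, ⟨e.trans e₁.symm⟩⟩, ⟨2, ⟨e.trans e₂.symm⟩⟩]

theorem numExtremal_of_six_le {h : ℕ} (hh : 6 ≤ h) : numExtremal 3 3 h = 2 := by
  obtain ⟨p₁, ⟨e₁⟩⟩ := exists_extremalGraph_iso (by omega) (L₁_isOptimal (h := h) (by omega))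
  obtain ⟨p₂, ⟨e₂⟩⟩ := exists_extremalGraph_iso (by omega) (L₂_isOptimal (h := h) (by omega))
  have n12 := L₁_not_iso_L₂ (h := h) (by omega)
  refine numExtremal_eq ![p₁, p₂] ?_ fun p => ?_
  · rintro k l ⟨e⟩
    fin_cases k <;> fin_cases l <;> first
      | rfl
      | exact (n12.false (e₁.symm.trans (RelIso.trans e e₂))).elim
      | exact (n12.false (e₁.symm.trans (RelIso.trans e.symm e₂))).elim
  · rcases (isOptimal_iff_iso_L hh).mp ((isExtremalFor_iff (by omega)).mp p.2) with
      ⟨⟨e⟩⟩ | ⟨⟨e⟩⟩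
    exacts [⟨0, ⟨e.trans e₁.symm⟩⟩, ⟨1, ⟨e.trans e₂.symm⟩⟩]

end Extremal

end SimpleGraph

theorem theorem3 :
    -- for every `h ≥ 4` the extremal graphs are exactly the `h`-optimal graphs
    (∀ h : ℕ, 4 ≤ h → ∀ (V : Type u) [Finite V] (G : SimpleGraph V),
      G.IsExtremalFor 3 3 h ↔ G.IsOptimal h) ∧
    -- `h = 4`: seven graphs
    SimpleGraph.numExtremal 3 3 4 = 7 ∧
    (∀ (V : Type u) [Finite V] (G : SimpleGraph V),
      G.IsExtremalFor 3 3 4 ↔ ∃ k : Fin 7, Nonempty (G ≃g SimpleGraph.fourOptimal k)) ∧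
    -- `h = 5`: three graphs
    SimpleGraph.numExtremal 3 3 5 = 3 ∧
    (∀ (V : Type u) [Finite V] (G : SimpleGraph V),
      G.IsExtremalFor 3 3 5 ↔
        Nonempty (G ≃g SimpleGraph.L₀) ∨ Nonempty (G ≃g SimpleGraph.L₁ 5) ∨
          Nonempty (G ≃g SimpleGraph.L₂ 5)) ∧
    -- `h ≥ 6`: two graphs
    (∀ h : ℕ, 6 ≤ h →
      SimpleGraph.numExtremal 3 3 h = 2 ∧
      ∀ (V : Type u) [Finite V] (G : SimpleGraph V),
        G.IsExtremalFor 3 3 h ↔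
          Nonempty (G ≃g SimpleGraph.L₁ h) ∨ Nonempty (G ≃g SimpleGraph.L₂ h)) := by
  refine ⟨fun h hh V _ G => SimpleGraph.isExtremalFor_iff hh, SimpleGraph.numExtremal_four,
    fun V _ G => ?_, SimpleGraph.numExtremal_five, fun V _ G => ?_, fun h hh =>
    ⟨SimpleGraph.numExtremal_of_six_le hh, fun V _ G => ?_⟩⟩
  · rw [SimpleGraph.isExtremalFor_iff le_rfl, SimpleGraph.isOptimal_four_iff]
  · rw [SimpleGraph.isExtremalFor_iff (by omega), SimpleGraph.isOptimal_five_iff]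
  · rw [SimpleGraph.isExtremalFor_iff (by omega), SimpleGraph.isOptimal_iff_iso_L hh]
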